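/- Let $r\ge 1$ be an integer, let $0<\vartheta<\tfrac12$, and let $P_1,P_2$ be polynomials with real coefficients. For $T>1$ put $y=T^{\vartheta}$ and $$H_1(s)=\sum_{n\le y}\frac{d_{r+1}(n)P_1[n]}{n^s},\qquad H_2(s)=\sum_{n\le y}\frac{d_r(n)P_2[n]}{n^s},\qquad P_j[n]=P_j\!\left(\frac{\log (y/n)}{\log y}\right),$$ where $d_k(n)$ is the coefficient of $n^{-s}$ in the Dirichlet series of $\zeta(s)^k$. Let $$a_k=\prod_p\left(\left(1-\frac1p\right)^{k^2}\sum_{n\ge0}\frac{d_k(p^n)^2}{p^n}\right),\qquad Q_r(x)=\int_0^x t^rP_1(x-t)\,dt.$$ Then, as $T\to\infty$ with $r,\vartheta,P_1,P_2$ fixed, $$\int_T^{2T}\zeta(\tfrac12+it)H_1(\tfrac12-it)H_2(\tfrac12+it)\,dt=\frac{a_{r+1}T(\log y)^{(r+1)^2}}{\Gamma(r+1)\Gamma(r(r+1))}\int_0^1(1-x)^{r(r+1)-1}Q_r(x)P_2(x)\,dx+o\!\left(T(\log y)^{(r+1)^2}\right).$$ In particular, if the integral $\int_0^1(1-x)^{r(r+1)-1}Q_r(x)P_2(x)\,dx$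 is nonzero, then the left-hand side is asymptotic (in the sense that the ratio tends to $1$) to the main term $$\frac{a_{r+1}T(\log y)^{(r+1)^2}}{\Gamma(r+1)\Gamma(r(r+1))}\int_0^1(1-x)^{r(r+1)-1}Q_r(x)P_2(x)\,dx.$$ -/

import Mathlib

open Filter Asymptotics
open scoped Polynomial

/-- The generalized divisor function `d_k(n)`: the coefficient of `n^{-s}` in the Dirichlet series
of `ζ(s)^k`, i.e. the value at `n` of the `k`-th power, under Dirichlet convolution, of the
arithmetic function that is constantly `1` on positive integers. -/
def divisorFn (k n : ℕ) : ℕ := (ArithmeticFunction.zeta ^ k) n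

/-- The arithmetic constant
`a_k = ∏_p (1 - 1/p)^{k^2} ∑_{n ≥ 0} d_k(p^n)^2 / p^n`. -/
noncomputable def arithConst (k : ℕ) : ℝ :=
  ∏' p : Nat.Primes, (1 - 1 / (p : ℝ)) ^ (k ^ 2) *
    ∑' n : ℕ, (divisorFn k ((p : ℕ) ^ n) : ℝ) ^ 2 / (p : ℝ) ^ n

/-- The smoothing weight `P[n] = P(log (y / n) / log y)`. -/
noncomputable def smoothWeight (P : ℝ[X]) (y : ℝ) (n : ℕ) : ℝ :=
  P.eval (Real.log (y / n) / Real.log y)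

/-- The Dirichlet polynomial `∑_{1 ≤ n ≤ y} d_k(n) P[n] n^{-s}`. -/
noncomputable def dirichletPoly (k : ℕ) (P : ℝ[X]) (y : ℝ) (s : ℂ) : ℂ :=
  ∑ n ∈ Finset.Icc 1 ⌊y⌋₊, ((divisorFn k n : ℝ) * smoothWeight P y n : ℝ) / (n : ℂ) ^ s

/-- `Q_r(x) = ∫_0^x t^r P(x - t) dt`. -/
noncomputable def fracConv (r : ℕ) (P : ℝ[X]) (x : ℝ) : ℝ :=
  ∫ t in (0 : ℝ)..x, t ^ r * P.eval (x - t)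

/-- The cross term `∫_T^{2T} ζ(1/2 + it) H₁(1/2 - it) H₂(1/2 + it) dt`, where
`H₁(s) = ∑_{n ≤ y} d_{r+1}(n) P₁[n] n^{-s}`, `H₂(s) = ∑_{n ≤ y} d_r(n) P₂[n] n^{-s}`,
and `y = T ^ θ`. -/
noncomputable def crossMoment (r : ℕ) (θ : ℝ) (P₁ P₂ : ℝ[X]) (T : ℝ) : ℂ :=
  ∫ t in T..(2 * T),
    riemannZeta (1 / 2 + Complex.I * (t : ℂ)) *
      dirichletPoly (r + 1) P₁ (T ^ θ) (1 / 2 - Complex.I * (t : ℂ)) *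
      dirichletPoly r P₂ (T ^ θ) (1 / 2 + Complex.I * (t : ℂ))

/-- The weighted integral `∫_0^1 (1 - x)^{r(r+1)-1} Q_r(x) P₂(x) dx`
(for `r ≥ 1` the exponent is at least `1`). -/
noncomputable def crossIntegral (r : ℕ) (P₁ P₂ : ℝ[X]) : ℝ :=
  ∫ x in (0 : ℝ)..1, (1 - x) ^ (r * (r + 1) - 1) * fracConv r P₁ x * P₂.eval x

/-- The main term
`a_{r+1} T (log y)^{(r+1)^2} / (Γ(r+1) Γ(r(r+1))) ∫_0^1 (1 - x)^{r(r+1)-1} Q_r(x) P₂(x) dx`,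
with `y = T ^ θ`. -/
noncomputable def crossMain (r : ℕ) (θ : ℝ) (P₁ P₂ : ℝ[X]) (T : ℝ) : ℝ :=
  arithConst (r + 1) * T * Real.log (T ^ θ) ^ ((r + 1) ^ 2) /
      (Real.Gamma ((r : ℝ) + 1) * Real.Gamma ((r : ℝ) * ((r : ℝ) + 1))) *
    crossIntegral r P₁ P₂

/-! The proof has two halves: reduction to a diagonal sum, then a Tauberian evaluation of that sum.

Reduction. Put `s = 1/2 + it` and move the integral of `ζ(s) H₁(1-s) H₂(s)` to a line `Re s = c`
slightly to the right of `1`. The rectangle lies in `Im s ≥ T`, so the pole of `ζ` is not crossed,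
and the horizontal sides are controlled by the elementary bound `ζ(s) ≪ √t` together with `H₁(1-s)
H₂(s) ≪ y^c` up to logarithms. On the new line the series for `ζ` converges absolutely, and the
terms are constant multiples of `(m/(nk))^{it}`: those with `m = nk` integrate to `T/m`, and the
others oscillate and contribute `O(y^{c+1})` up to logarithms. Because `θ < 1/2`, `c` can be chosen
so that all errors are `o(T)` (`norm_twisted_moment_sub_le`, `crossMoment_sub_diagonal_isLittleO`).

Diagonal. What remains is the sum over `kn ≤ y` of `d_{r+1}(kn) d_r(n) P₁[kn] P₂[n] / (kn)`. The
nonnegative double series `D(s,w) = ∑ d_{r+1}(kn) d_r(n) k^{-1-s} n^{-1-w}` equals `ζ(1+s)^{r+1}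
ζ(1+w)^{r(r+1)}` times an Euler product that tends to `a_{r+1}` at the origin (`tsum_pairTerm_eq`).
Hence `σ^{(r+1)²} D(ασ, βσ) → a_{r+1} α^{-(r+1)} β^{-r(r+1)}` as `σ → 0+` (`tendsto_tsum_pairTerm`).

A two-variable form of Karamata's Tauberian argument converts this into asymptotics of truncated
sums. Place the mass `σ^{(r+1)²}` times the `(k,n)` term of `D(σ,σ)` at the point `(k^{-σ}, n^{-σ})`
of the unit square. The `(a,b)` moment of this measure is the normalized `D((a+1)σ, (b+1)σ)`, so the
moments converge to those of `a_{r+1}` times the law of `(e^{-U}, e^{-V})`, with `U`, `V`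
independent gamma variables of shapes `r+1` and `r(r+1)`. Weierstrass approximation upgrades this to
continuous test functions, and to ones cut off along a null set
(`tendsto_tsum_indicator_of_moments`). With `σ = 1/log y` the condition `kn ≤ y` becomes `U + V ≤
1`; integrating out `U` produces `Q_r(1-V)`, and integrating out `V` produces the stated integral
(`integral_momentWeight`, `tendsto_diagonalSum`). -/

open Topology

/-! ### Divisor functions: inequalities and partial sums -/

theorem divisorFn_zero_right (k : ℕ) : divisorFn k 0 = 0 := by simp [divisorFn]

theorem divisorFn_succ (k n : ℕ) :
    divisorFn (k + 1) n = ∑ d ∈ n.divisors, divisorFn k d := by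
  simp only [divisorFn, pow_succ]
  rw [ArithmeticFunction.mul_zeta_apply]

theorem divisorFn_isMultiplicative (k : ℕ) : (ArithmeticFunction.zeta ^ k).IsMultiplicative := by
  induction k with
  | zero => exact ArithmeticFunction.isMultiplicative_one
  | succ k ih => rw [pow_succ]; exact ih.mul ArithmeticFunction.isMultiplicative_zeta

theorem divisorFn_one_right (k : ℕ) : divisorFn k 1 = 1 := (divisorFn_isMultiplicative k).1

theorem divisorFn_prime (k : ℕ) {p : ℕ} (hp : p.Prime) : divisorFn k p = k := by
  induction k with
  | zero => simp [divisorFn, hp.one_lt.ne']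
  | succ k ih =>
    rw [divisorFn_succ, hp.sum_divisors, ih, divisorFn_one_right]

/-- Every divisor of `mn` is a product of a divisor of `m` and one of `n`. Summing over all such
pairs can only count a divisor more than once, so the induction on `k` goes through. -/
theorem divisorFn_mul_le (k m n : ℕ) :
    divisorFn k (m * n) ≤ divisorFn k m * divisorFn k n := by
  induction k generalizing m n with
  | zero =>
    simp only [divisorFn, pow_zero, ArithmeticFunction.one_apply]
    by_cases h : m * n = 1
    · obtain ⟨rfl, rfl⟩ := mul_eq_one.1 h
      simp
    · simp [h]
  | succ k ih =>
    open scoped Pointwise in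
    rw [divisorFn_succ, divisorFn_succ, divisorFn_succ, Nat.divisors_mul, Finset.sum_mul_sum,
      ← Finset.sum_product']
    rw [← Finset.image_mul_product]
    refine (Finset.sum_image_le_of_nonneg (fun _ _ => Nat.zero_le _)).trans ?_
    exact Finset.sum_le_sum fun x _ => ih _ _

/-- Writing `d_{(a+1)b}` as the convolution of `d_{ab}` and `d_b` reduces each step to
submultiplicativity of `d_b`. It serves to dominate `d_{r+1}(n) d_r(n)` by a single divisor
function. -/
theorem divisorFn_mul_divisorFn_le (a b n : ℕ) :
    divisorFn a n * divisorFn b n ≤ divisorFn (a * b) n := by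
  induction a generalizing n with
  | zero =>
    simp only [divisorFn, pow_zero, zero_mul, ArithmeticFunction.one_apply]
    by_cases h : n = 1
    · subst h; simp [(divisorFn_isMultiplicative b).1]
    · simp [h]
  | succ a ih =>
    have h : divisorFn ((a + 1) * b) n
        = ∑ x ∈ n.divisorsAntidiagonal, divisorFn (a * b) x.1 * divisorFn b x.2 := by
      simp only [divisorFn, add_mul, one_mul, pow_add]
      rw [ArithmeticFunction.mul_apply]
    rw [h, divisorFn_succ, Finset.sum_mul,
      Nat.sum_divisorsAntidiagonal (f := fun x y => divisorFn (a * b) x * divisorFn b y)]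
    refine Finset.sum_le_sum fun d hd => ?_
    have hdn := Nat.dvd_of_mem_divisors hd
    calc divisorFn a d * divisorFn b n
        = divisorFn a d * divisorFn b (d * (n / d)) := by rw [Nat.mul_div_cancel' hdn]
      _ ≤ divisorFn a d * (divisorFn b d * divisorFn b (n / d)) :=
          Nat.mul_le_mul_left _ (divisorFn_mul_le _ _ _)
      _ = (divisorFn a d * divisorFn b d) * divisorFn b (n / d) := by ring
      _ ≤ _ := Nat.mul_le_mul_right _ (ih d)

theorem divisorFn_prime_pow_le (k : ℕ) {p : ℕ} (hp : p.Prime) (e : ℕ) :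
    divisorFn k (p ^ e) ≤ (e + 1) ^ k := by
  induction k generalizing e with
  | zero =>
    simp only [divisorFn, pow_zero, ArithmeticFunction.one_apply]
    split_ifs <;> simp
  | succ k ih =>
    rw [divisorFn_succ, Nat.sum_divisors_prime_pow hp, pow_succ']
    calc _ ≤ ∑ _x ∈ Finset.range (e + 1), (e + 1) ^ k := by
          refine Finset.sum_le_sum fun x hx => (ih x).trans ?_
          exact Nat.pow_le_pow_left (by simpa using Finset.mem_range.1 hx) _
      _ = _ := by simp

/-- Partial sums of `d_k h` are bounded by `k`-th powers of partial sums of `h`. -/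
theorem sum_divisorFn_mul_le (h : ℕ → ℝ) (h0 : ∀ n, 0 ≤ h n) (h1 : h 1 = 1)
    (hm : ∀ m n, h (m * n) = h m * h n) (k N : ℕ) :
    ∑ n ∈ Finset.Icc 1 N, (divisorFn k n : ℝ) * h n ≤ (∑ n ∈ Finset.Icc 1 N, h n) ^ k := by
  induction k with
  | zero =>
    simp only [divisorFn, pow_zero, ArithmeticFunction.one_apply]
    calc _ = ∑ n ∈ Finset.Icc 1 N, if n = 1 then h 1 else 0 := by
          refine Finset.sum_congr rfl fun n _ => ?_
          split_ifs with hn <;> simp [hn]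
      _ ≤ 1 := by
          rw [Finset.sum_ite_eq', h1]; split_ifs <;> norm_num
  | succ k ih =>
    have key : ∑ n ∈ Finset.Icc 1 N, (divisorFn (k + 1) n : ℝ) * h n
        ≤ ∑ x ∈ Finset.Icc 1 N ×ˢ Finset.Icc 1 N, ((divisorFn k x.1 : ℝ) * h x.1) * h x.2 := by
      have e1 : ∀ n ∈ Finset.Icc 1 N, (divisorFn (k + 1) n : ℝ) * h n
          = ∑ x ∈ n.divisorsAntidiagonal, ((divisorFn k x.1 : ℝ) * h x.1) * h x.2 := by
        intro n _
        have h2 : divisorFn (k + 1) n = ∑ x ∈ n.divisorsAntidiagonal, divisorFn k x.1 := by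
          rw [divisorFn_succ, Nat.sum_divisorsAntidiagonal (f := fun x _ => divisorFn k x)]
        rw [h2, Nat.cast_sum, Finset.sum_mul]
        refine Finset.sum_congr rfl fun x hx => ?_
        rw [← (Nat.mem_divisorsAntidiagonal.1 hx).1, hm]; ring
      rw [Finset.sum_congr rfl e1, Finset.sum_sigma']
      -- The factorizations of all `n ≤ N` embed in the box `[1,N]²`, since the pair determines its
      -- product.
      rw [← Finset.sum_image (s := (Finset.Icc 1 N).sigma fun n => n.divisorsAntidiagonal)
        (g := fun x => x.2) (f := fun x => ((divisorFn k x.1 : ℝ) * h x.1) * h x.2)]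
      · refine Finset.sum_le_sum_of_subset_of_nonneg ?_ fun x _ _ =>
          mul_nonneg (mul_nonneg (Nat.cast_nonneg _) (h0 _)) (h0 _)
        intro x hx
        simp only [Finset.mem_image, Finset.mem_sigma, Finset.mem_Icc,
          Nat.mem_divisorsAntidiagonal] at hx
        obtain ⟨⟨n, y⟩, ⟨⟨_, h2⟩, h3, h4⟩, rfl⟩ := hx
        simp only at h2 h3 h4 ⊢
        have := Nat.pos_of_ne_zero h4
        have ha : 0 < y.1 := Nat.pos_of_ne_zero fun h => by simp [h] at h3; omega
        have hb : 0 < y.2 := Nat.pos_of_ne_zero fun h => by simp [h] at h3; omega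
        have := Nat.le_mul_of_pos_right y.1 hb
        have := Nat.le_mul_of_pos_left y.2 ha
        simp only [Finset.mem_product, Finset.mem_Icc]
        omega
      · rintro ⟨n, x⟩ hx ⟨m, y⟩ hy hxy
        simp only [Finset.coe_sigma, Set.mem_sigma_iff, Finset.mem_coe,
          Nat.mem_divisorsAntidiagonal] at hx hy hxy
        subst hxy
        obtain rfl : n = m := hx.2.1.symm.trans hy.2.1
        rfl
    refine key.trans ?_
    rw [Finset.sum_product' (f := fun a b => ((divisorFn k a : ℝ) * h a) * h b),
      ← Finset.sum_mul_sum, pow_succ]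
    exact mul_le_mul_of_nonneg_right ih (Finset.sum_nonneg fun _ _ => h0 _)

theorem sum_divisorFn_div_le (k : ℕ) {y : ℝ} (hy : 1 ≤ y) :
    ∑ n ∈ Finset.Icc 1 ⌊y⌋₊, (divisorFn k n : ℝ) / n ≤ (1 + Real.log y) ^ k := by
  have h := sum_divisorFn_mul_le (fun n => (n : ℝ)⁻¹) (fun n => by positivity) (by simp)
    (fun m n => by push_cast; rw [mul_inv]) k ⌊y⌋₊
  simp only [← div_eq_mul_inv] at h
  refine h.trans (pow_le_pow_left₀ (Finset.sum_nonneg fun _ _ => by positivity) ?_ k)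
  have h2 := harmonic_floor_le_one_add_log y hy
  rwa [harmonic_eq_sum_Icc, Rat.cast_sum, Finset.sum_congr rfl fun i _ => Rat.cast_inv_nat i] at h2

/-- The partial sums are at most `ζ(1+s)^k`. -/
theorem summable_divisorFn_mul_rpow (k : ℕ) {s : ℝ} (hs : 0 < s) :
    Summable fun n : ℕ => (divisorFn k n : ℝ) * (n : ℝ) ^ (-1 - s) := by
  have hsum : Summable fun n : ℕ => (n : ℝ) ^ (-1 - s) := Real.summable_nat_rpow.2 (by linarith)
  refine summable_of_sum_range_le (c := (∑' n : ℕ, (n : ℝ) ^ (-1 - s)) ^ k)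
    (fun n => by positivity) fun N => ?_
  have h := sum_divisorFn_mul_le (fun n => (n : ℝ) ^ (-1 - s)) (fun n => by positivity) (by simp)
    (fun m n => by push_cast; exact Real.mul_rpow (by positivity) (by positivity)) k N
  refine le_trans ?_ (h.trans ?_)
  · calc _ ≤ ∑ n ∈ insert 0 (Finset.Icc 1 N), (divisorFn k n : ℝ) * (n : ℝ) ^ (-1 - s) := by
          refine Finset.sum_le_sum_of_subset_of_nonneg ?_ fun n _ _ => by positivity
          intro n hn
          simp only [Finset.mem_range, Finset.mem_insert, Finset.mem_Icc] at hn ⊢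
          omega
      _ ≤ _ := by rw [Finset.sum_insert (by simp)]; simp [divisorFn_zero_right]
  · exact pow_le_pow_left₀ (Finset.sum_nonneg fun _ _ => by positivity)
      (hsum.sum_le_tsum _ fun _ _ => by positivity) k

/-! ### A polynomial bound for `ζ` in the strip -/

/-- The `k`-th local error in the comparison of `∑ n^{-s}` with `∫ x^{-s} dx`. -/
noncomputable def zetaLocalError (k : ℕ) (s : ℂ) : ℂ :=
  ((k : ℂ) + 1) ^ (-s) - (((k : ℂ) + 1) ^ (1 - s) - (k : ℂ) ^ (1 - s)) / (1 - s)

theorem norm_natCast_add_one_cpow_sub_le {k : ℕ} (hk : 1 ≤ k) {s : ℂ} (hs : 0 < s.re) {x : ℝ}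
    (hx : x ∈ Set.Icc (k : ℝ) (k + 1)) :
    ‖((k : ℂ) + 1) ^ (-s) - (x : ℂ) ^ (-s)‖ ≤ ‖s‖ * (k : ℝ) ^ (-s.re - 1) := by
  have hk0 : (0 : ℝ) < k := by exact_mod_cast hk
  have hd : ∀ u ∈ Set.Icc (k : ℝ) (k + 1), HasDerivWithinAt (fun u : ℝ => (u : ℂ) ^ (-s))
      (-s * (u : ℂ) ^ (-s - 1)) (Set.Icc (k : ℝ) (k + 1)) u := fun u hu =>
    (hasDerivAt_ofReal_cpow_const (hk0.trans_le hu.1).ne' (neg_ne_zero.2 fun h => by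
      simp [h] at hs)).hasDerivWithinAt
  have h := Convex.norm_image_sub_le_of_norm_hasDerivWithin_le (C := ‖s‖ * (k : ℝ) ^ (-s.re - 1))
    hd ?_ (convex_Icc _ _) hx (Set.right_mem_Icc.2 (by linarith))
  · push_cast at h
    refine h.trans (mul_le_of_le_one_right (by positivity) ?_)
    rw [Real.norm_of_nonneg] <;> linarith [hx.1, hx.2]
  · intro u hu
    have hu0 := hk0.trans_le hu.1
    rw [norm_mul, norm_neg, Complex.norm_cpow_eq_rpow_re_of_pos hu0]
    simp only [Complex.sub_re, Complex.neg_re, Complex.one_re]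
    exact mul_le_mul_of_nonneg_left
      (Real.rpow_le_rpow_of_nonpos hk0 hu.1 (by linarith)) (norm_nonneg _)

/-- The error is the increment over `[k, k+1]` of `u (k+1)^{-s} - u^{1-s}/(1-s)`, whose derivative
is `(k+1)^{-s} - u^{-s}`; the mean value inequality then applies. The extra power of `k` makes the
errors summable for all `Re s > 0`. -/
theorem norm_zetaLocalError_le {k : ℕ} (hk : 1 ≤ k) {s : ℂ} (hs : 0 < s.re) (hs1 : s ≠ 1) :
    ‖zetaLocalError k s‖ ≤ ‖s‖ * (k : ℝ) ^ (-s.re - 1) := by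
  have hk0 : (0 : ℝ) < k := by exact_mod_cast hk
  have hs1' : 1 - s ≠ 0 := sub_ne_zero.2 hs1.symm
  have hd : ∀ u ∈ Set.Icc (k : ℝ) (k + 1), HasDerivWithinAt
      (fun u : ℝ => (u : ℂ) * ((k : ℂ) + 1) ^ (-s) - (u : ℂ) ^ (1 - s) / (1 - s))
      (((k : ℂ) + 1) ^ (-s) - (u : ℂ) ^ (-s)) (Set.Icc (k : ℝ) (k + 1)) u := by
    intro u hu
    have h1 := hasDerivAt_ofReal_cpow_const' (r := -s) (hk0.trans_le hu.1).ne'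
      fun h => hs1 (neg_injective h)
    rw [neg_add_eq_sub] at h1
    have h2 : HasDerivAt (fun u : ℝ => (u : ℂ) * ((k : ℂ) + 1) ^ (-s)) (((k : ℂ) + 1) ^ (-s)) u := by
      simpa using (Complex.ofRealCLM.hasDerivAt (x := u)).mul_const (((k : ℂ) + 1) ^ (-s))
    exact (h2.sub h1).hasDerivWithinAt
  have h := Convex.norm_image_sub_le_of_norm_hasDerivWithin_le (C := ‖s‖ * (k : ℝ) ^ (-s.re - 1))
    hd (fun u hu => norm_natCast_add_one_cpow_sub_le hk hs hu) (convex_Icc _ _)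
    (Set.left_mem_Icc.2 (by linarith)) (Set.right_mem_Icc.2 (by linarith))
  push_cast at h
  rw [show (k : ℝ) + 1 - k = 1 by ring, norm_one, mul_one] at h
  refine (congrArg norm ?_).trans_le h
  unfold zetaLocalError
  ring

theorem zetaLocalError_differentiableAt {k : ℕ} (hk : 1 ≤ k) {s : ℂ} (hs1 : s ≠ 1) :
    DifferentiableAt ℂ (zetaLocalError k) s := by
  have hk0 : (k : ℂ) ≠ 0 := by exact_mod_cast (by omega : k ≠ 0)
  have hk1 : (k : ℂ) + 1 ≠ 0 := by exact_mod_cast (by omega : k + 1 ≠ 0)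
  unfold zetaLocalError
  refine DifferentiableAt.sub ?_ (DifferentiableAt.div ?_ (by fun_prop) (sub_ne_zero.2 hs1.symm))
  · exact DifferentiableAt.const_cpow (by fun_prop) (Or.inl hk1)
  · exact (DifferentiableAt.const_cpow (by fun_prop) (Or.inl hk1)).sub
      (DifferentiableAt.const_cpow (by fun_prop) (Or.inl hk0))

theorem summable_natCast_add_rpow (N : ℕ) {σ : ℝ} (hσ : 0 < σ) :
    Summable fun j : ℕ => ((N + j : ℕ) : ℝ) ^ (-σ - 1) := by
  have := (summable_nat_add_iff N).2 (Real.summable_nat_rpow.2 (by linarith : -σ - 1 < -1))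
  simpa [add_comm] using this

theorem riemannZeta_eq_sum_add_of_one_lt_re {N : ℕ} (hN : 1 ≤ N) {s : ℂ} (hs : 1 < s.re) :
    riemannZeta s = ∑ n ∈ Finset.Icc 1 N, (n : ℂ) ^ (-s) + (N : ℂ) ^ (1 - s) / (s - 1) +
      ∑' j : ℕ, zetaLocalError (N + j) s := by
  have hs1 : s ≠ 1 := fun h => by simp [h] at hs
  have hs1' : 1 - s ≠ 0 := sub_ne_zero.2 hs1.symm
  have hs0 : s ≠ 0 := fun h => by simp [h] at hs; norm_num at hs
  have hsum : Summable fun n : ℕ => (n : ℂ) ^ (-s) := by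
    simpa [Complex.cpow_neg] using Complex.summable_one_div_nat_cpow.2 hs
  have hz : riemannZeta s = ∑' n : ℕ, (n : ℂ) ^ (-s) := by
    rw [zeta_eq_tsum_one_div_nat_cpow hs]
    simp [Complex.cpow_neg]
  have hD : Summable fun j : ℕ => zetaLocalError (N + j) s := by
    refine Summable.of_norm_bounded
      ((summable_natCast_add_rpow N (by linarith : 0 < s.re)).mul_left ‖s‖) fun j => ?_
    simpa using norm_zetaLocalError_le (k := N + j) (by omega) (by linarith) hs1
  -- The integral parts telescope, leaving only the boundary powers at `N` and `N + J`.
  have hpart : ∀ J : ℕ, ∑ j ∈ Finset.range J, zetaLocalError (N + j) s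
      = ∑ n ∈ Finset.range (N + J + 1), (n : ℂ) ^ (-s) - ∑ n ∈ Finset.Icc 1 N, (n : ℂ) ^ (-s)
        - (((N + J : ℕ) : ℂ) ^ (1 - s) - (N : ℂ) ^ (1 - s)) / (1 - s) := by
    intro J
    induction J with
    | zero =>
      have h0 : ∑ n ∈ Finset.range (N + 1), (n : ℂ) ^ (-s) = ∑ n ∈ Finset.Icc 1 N, (n : ℂ) ^ (-s) := by
        rw [Finset.range_eq_Ico, Finset.sum_eq_sum_Ico_succ_bot (by omega : 0 < N + 1)]
        simp [Complex.zero_cpow (neg_ne_zero.2 hs0), Finset.Ico_add_one_right_eq_Icc]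
      simp [h0]
    | succ J ih =>
      rw [Finset.sum_range_succ, ih, ← add_assoc, Finset.sum_range_succ _ (N + J + 1)]
      unfold zetaLocalError
      push_cast
      ring
  have hlim : Tendsto (fun J : ℕ => ((N + J : ℕ) : ℂ) ^ (1 - s)) atTop (𝓝 0) := by
    rw [tendsto_zero_iff_norm_tendsto_zero]
    have h : Tendsto (fun x : ℝ => x ^ (-(s.re - 1))) atTop (𝓝 0) :=
      tendsto_rpow_neg_atTop (by linarith)
    have h2 : Tendsto (fun J : ℕ => ((N + J : ℕ) : ℝ)) atTop atTop :=
      tendsto_natCast_atTop_atTop.comp (tendsto_add_atTop_nat N |>.congr fun n => add_comm _ _)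
    refine (h.comp h2).congr fun J => ?_
    rw [Complex.norm_natCast_cpow_of_pos (by omega)]
    simp
  have h1 := hD.hasSum.tendsto_sum_nat
  have h2 : Tendsto (fun J : ℕ => ∑ j ∈ Finset.range J, zetaLocalError (N + j) s) atTop
      (𝓝 (riemannZeta s - ∑ n ∈ Finset.Icc 1 N, (n : ℂ) ^ (-s)
        - (0 - (N : ℂ) ^ (1 - s)) / (1 - s))) := by
    simp_rw [hpart]
    refine (Tendsto.sub_const ?_ _).sub ((hlim.sub_const _).div_const _)
    rw [hz]
    have h3 := hsum.hasSum.tendsto_sum_nat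
    exact h3.comp (tendsto_add_atTop_nat (N + 1) |>.congr fun n => by ring)
  rw [tendsto_nhds_unique h1 h2, show s - 1 = -(1 - s) by ring]
  field_simp
  ring

/-- Analytic continuation: both sides are holomorphic on a convex region of the upper half plane,
which avoids the pole, and they agree near `2 + i`. The region is cut by a ball so that the factor
`‖s‖` in the error bounds stays bounded and the series converges uniformly. -/
theorem riemannZeta_eq_sum_add {N : ℕ} (hN : 1 ≤ N) {s : ℂ} (hs : 1 / 4 < s.re) (hi : 0 < s.im) :
    riemannZeta s = ∑ n ∈ Finset.Icc 1 N, (n : ℂ) ^ (-s) + (N : ℂ) ^ (1 - s) / (s - 1) +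
      ∑' j : ℕ, zetaLocalError (N + j) s := by
  set M : ℝ := ‖s‖ + 4
  set U : Set ℂ := ({z : ℂ | 1 / 4 < z.re} ∩ {z : ℂ | 0 < z.im}) ∩ Metric.ball 0 M
  have hU : IsOpen U := ((isOpen_lt continuous_const Complex.continuous_re).inter
    (isOpen_lt continuous_const Complex.continuous_im)).inter Metric.isOpen_ball
  have hconv : Convex ℝ U := ((convex_halfSpace_re_gt _).inter (convex_halfSpace_im_gt _)).inter
    (convex_ball _ _)
  have hne : ∀ z ∈ U, z ≠ 1 := by
    rintro z ⟨⟨_, hz⟩, _⟩ rfl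
    simp at hz
  have hz0 : (2 + Complex.I : ℂ) ∈ U := by
    refine ⟨⟨?_, ?_⟩, ?_⟩
    · simp; norm_num
    · simp
    · rw [mem_ball_zero_iff]
      refine (norm_add_le _ _).trans_lt ?_
      simp only [Complex.norm_ofNat, Complex.norm_I, M]
      have := norm_nonneg s
      linarith
  have hsU : s ∈ U := ⟨⟨hs, hi⟩, by simp [M]⟩
  have hN0 : (N : ℂ) ≠ 0 := by exact_mod_cast (by omega : N ≠ 0)
  have hf : DifferentiableOn ℂ riemannZeta U := fun z hz =>
    (differentiableAt_riemannZeta (hne z hz)).differentiableWithinAt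
  have hg : DifferentiableOn ℂ (fun s : ℂ => ∑ n ∈ Finset.Icc 1 N, (n : ℂ) ^ (-s)
      + (N : ℂ) ^ (1 - s) / (s - 1) + ∑' j : ℕ, zetaLocalError (N + j) s) U := by
    refine DifferentiableOn.add (fun z hz => DifferentiableAt.differentiableWithinAt ?_) ?_
    · refine DifferentiableAt.add (DifferentiableAt.fun_sum fun n hn => ?_)
        (DifferentiableAt.div ?_ (by fun_prop) (sub_ne_zero.2 (hne z hz)))
      · refine DifferentiableAt.const_cpow (by fun_prop) (Or.inl ?_)
        have := (Finset.mem_Icc.1 hn).1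
        exact_mod_cast (by omega : n ≠ 0)
      · exact DifferentiableAt.const_cpow (by fun_prop) (Or.inl hN0)
    · refine Complex.differentiableOn_tsum_of_summable_norm
        ((summable_natCast_add_rpow N (by norm_num : (0 : ℝ) < 1 / 4)).mul_left M)
        (fun j z hz => (zetaLocalError_differentiableAt (by omega)
          (hne z hz)).differentiableWithinAt) hU fun j z hz => ?_
      have h1 : 1 / 4 < z.re := hz.1.1
      refine (norm_zetaLocalError_le (k := N + j) (by omega) (by linarith) (hne z hz)).trans ?_
      have h2 : ‖z‖ < M := by simpa using hz.2
      have h3 : (1 : ℝ) ≤ (N + j : ℕ) := by exact_mod_cast (by omega : 1 ≤ N + j)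
      have h4 : ((N + j : ℕ) : ℝ) ^ (-z.re - 1) ≤ ((N + j : ℕ) : ℝ) ^ (-(1 / 4 : ℝ) - 1) :=
        Real.rpow_le_rpow_of_exponent_le h3 (by linarith)
      exact mul_le_mul h2.le h4 (by positivity) (by positivity)
  refine (hf.analyticOnNhd hU).eqOn_of_preconnected_of_eventuallyEq (hg.analyticOnNhd hU)
    hconv.isPreconnected hz0 ?_ hsU
  have : ∀ᶠ z : ℂ in 𝓝 (2 + Complex.I), 1 < z.re :=
    (isOpen_lt continuous_const Complex.continuous_re).mem_nhds (by simp)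
  filter_upwards [this] with z hz using riemannZeta_eq_sum_add_of_one_lt_re hN hz

/-- A telescoping majorant, so that the tail of `∑ n^{-3/2}` from `N` on is at most `4/√N`. -/
theorem natCast_rpow_neg_three_halves_le {n : ℕ} (hn : 1 ≤ n) :
    (n : ℝ) ^ (-(1 / 2 : ℝ) - 1) ≤ 4 * (1 / √n - 1 / √((n + 1 : ℕ) : ℝ)) := by
  have hn0 : (1 : ℝ) ≤ n := by exact_mod_cast hn
  set a := √(n : ℝ)
  set b := √((n + 1 : ℕ) : ℝ)
  have ha : 0 < a := Real.sqrt_pos.2 (by linarith)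
  have hb : 0 < b := Real.sqrt_pos.2 (by positivity)
  have ha2 : a ^ 2 = n := Real.sq_sqrt (by linarith)
  have hb2 : b ^ 2 = n + 1 := by rw [Real.sq_sqrt (by positivity)]; push_cast; ring
  have hba : b ≤ 3 / 2 * a := abs_le_of_sq_le_sq' (by nlinarith) (by positivity) |>.2
  have hl : (n : ℝ) ^ (-(1 / 2 : ℝ) - 1) = 1 / a ^ 3 := by
    rw [Real.rpow_sub (by linarith), Real.rpow_neg (by linarith), ← Real.sqrt_eq_rpow, Real.rpow_one,
      ← ha2]
    simp only [Real.sqrt_sq ha.le]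
    field_simp
  have hr : 1 / a - 1 / b = 1 / (a * b * (a + b)) := by
    field_simp
    nlinarith
  rw [hl, hr, mul_one_div, div_le_div_iff₀ (by positivity) (by positivity)]
  have : b * (a + b) ≤ 4 * a ^ 2 := by nlinarith
  nlinarith

theorem tsum_natCast_add_rpow_le {N : ℕ} (hN : 1 ≤ N) :
    ∑' j : ℕ, ((N + j : ℕ) : ℝ) ^ (-(1 / 2 : ℝ) - 1) ≤ 4 / √N := by
  refine Real.tsum_le_of_sum_range_le (fun _ => by positivity) fun J => ?_
  calc _ ≤ ∑ j ∈ Finset.range J, (4 * (1 / √((N + j : ℕ) : ℝ)) -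
          4 * (1 / √((N + (j + 1) : ℕ) : ℝ))) := Finset.sum_le_sum fun j _ => by
        rw [← mul_sub]
        exact natCast_rpow_neg_three_halves_le (by omega)
    _ = 4 * (1 / √((N + 0 : ℕ) : ℝ)) - 4 * (1 / √((N + J : ℕ) : ℝ)) :=
        Finset.sum_range_sub' (fun j => 4 * (1 / √((N + j : ℕ) : ℝ))) J
    _ ≤ _ := by
        rw [add_zero, mul_one_div]
        exact sub_le_self _ (by positivity)

theorem sum_one_div_sqrt_le (N : ℕ) : ∑ n ∈ Finset.Icc 1 N, 1 / √(n : ℝ) ≤ 2 * √N := by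
  induction N with
  | zero => simp
  | succ N ih =>
    rw [Finset.sum_Icc_succ_top (by omega)]
    set a := √(N : ℝ)
    set b := √((N + 1 : ℕ) : ℝ)
    have ha : 0 ≤ a := Real.sqrt_nonneg _
    have hb : 0 < b := Real.sqrt_pos.2 (by positivity)
    have ha2 : a ^ 2 = N := Real.sq_sqrt (by positivity)
    have hb2 : b ^ 2 = N + 1 := by rw [Real.sq_sqrt (by positivity)]; push_cast; ring
    have : 1 / b ≤ 2 * b - 2 * a := by
      rw [div_le_iff₀ hb]
      nlinarith [sq_nonneg (b - a)]
    linarith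

/-- `ζ(σ + it) ≪ √t` uniformly for `1/2 ≤ σ ≤ 2` and `t ≥ 1`. -/
theorem norm_riemannZeta_le_sqrt {s : ℂ} (h1 : 1 / 2 ≤ s.re) (h2 : s.re ≤ 2) (h3 : 1 ≤ s.im) :
    ‖riemannZeta s‖ ≤ 30 * √s.im := by
  set t := s.im
  -- Length `N ≍ t` balances the sum, of size `√N`, against the tail, of size `t/√N`.
  set N := ⌈t⌉₊
  have hN : 1 ≤ N := Nat.one_le_ceil_iff.2 (by linarith)
  have hNt : t ≤ N := Nat.le_ceil t
  have hNt' : (N : ℝ) ≤ 2 * t := by linarith [(Nat.ceil_lt_add_one (by linarith : 0 ≤ t)).le]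
  have hN1 : (1 : ℝ) ≤ N := by exact_mod_cast hN
  have hs1 : s ≠ 1 := by
    rintro h
    have : t = 0 := by simp [t, h]
    linarith
  have hsn : ‖s‖ ≤ 3 * t := by
    refine (Complex.norm_le_abs_re_add_abs_im s).trans ?_
    rw [abs_of_nonneg (by linarith), abs_of_nonneg (by linarith)]
    change s.re + t ≤ _
    linarith
  have hst : √t ^ 2 = t := Real.sq_sqrt (by linarith)
  have hst0 : 0 < √t := Real.sqrt_pos.2 (by linarith)
  have hsN : √(N : ℝ) ≤ 2 * √t := by
    rw [Real.sqrt_le_left (by positivity)]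
    nlinarith
  have hsN' : √t ≤ √(N : ℝ) := Real.sqrt_le_sqrt hNt
  rw [riemannZeta_eq_sum_add hN (by linarith) (by linarith)]
  have b1 : ‖∑ n ∈ Finset.Icc 1 N, (n : ℂ) ^ (-s)‖ ≤ 4 * √t := by
    refine (norm_sum_le _ _).trans (le_trans (Finset.sum_le_sum fun n hn => ?_)
      ((sum_one_div_sqrt_le N).trans (by linarith)))
    have hn1 := (Finset.mem_Icc.1 hn).1
    rw [Complex.norm_natCast_cpow_of_pos (by omega), Real.sqrt_eq_rpow, one_div,
      ← Real.rpow_neg (by positivity)]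
    exact Real.rpow_le_rpow_of_exponent_le (by exact_mod_cast hn1) (by simp; linarith)
  have b2 : ‖(N : ℂ) ^ (1 - s) / (s - 1)‖ ≤ 2 * √t := by
    rw [norm_div, Complex.norm_natCast_cpow_of_pos (by omega)]
    have e1 : (N : ℝ) ^ (1 - s).re ≤ √N := by
      rw [Real.sqrt_eq_rpow]
      exact Real.rpow_le_rpow_of_exponent_le hN1 (by simp; linarith)
    have e2 : 1 ≤ ‖s - 1‖ := by
      refine le_trans ?_ (Complex.abs_im_le_norm _)
      simp only [Complex.sub_im, Complex.one_im, sub_zero]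
      exact h3.trans (le_abs_self _)
    rw [div_le_iff₀ (by linarith)]
    nlinarith
  have b3 : ‖∑' j : ℕ, zetaLocalError (N + j) s‖ ≤ 12 * √t := by
    have hS := (summable_natCast_add_rpow N (by norm_num : (0 : ℝ) < 1 / 2)).mul_left ‖s‖
    refine (tsum_of_norm_bounded hS.hasSum fun j => ?_).trans ?_
    · refine (norm_zetaLocalError_le (k := N + j) (by omega) (by linarith) hs1).trans ?_
      refine mul_le_mul_of_nonneg_left ?_ (norm_nonneg _)
      exact Real.rpow_le_rpow_of_exponent_le (by exact_mod_cast (by omega : 1 ≤ N + j))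
        (by linarith)
    · rw [tsum_mul_left]
      calc ‖s‖ * _ ≤ (3 * t) * (4 / √N) := mul_le_mul hsn (tsum_natCast_add_rpow_le hN)
            (by positivity) (by positivity)
        _ ≤ (3 * t) * (4 / √t) := by gcongr
        _ = 12 * √t := by
            nth_rw 1 [← hst]
            field_simp
            norm_num
  refine (norm_add₃_le).trans ?_
  linarith

/-! ### Twisted integrals to the right of the line `Re s = 1` -/

theorem norm_integral_exp_mul_I_le {l : ℝ} (hl : l ≠ 0) (a b : ℝ) :
    ‖∫ t in a..b, Complex.exp (l * Complex.I * t)‖ ≤ 2 / |l| := by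
  have hc : (l * Complex.I : ℂ) ≠ 0 := mul_ne_zero (by exact_mod_cast hl) Complex.I_ne_zero
  rw [integral_exp_mul_complex hc, norm_div, norm_mul, Complex.norm_I, mul_one, Complex.norm_real,
    Real.norm_eq_abs]
  refine div_le_div_of_nonneg_right ((norm_sub_le _ _).trans ?_) (abs_nonneg _)
  have h : ∀ x : ℝ, ‖Complex.exp (l * Complex.I * x)‖ = 1 := fun x => by
    rw [show (l * Complex.I * x : ℂ) = ((l * x : ℝ) : ℂ) * Complex.I by push_cast; ring,
      Complex.norm_exp_ofReal_mul_I]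
  rw [h, h]
  norm_num

/-- Distinct integers differ by at least `1`. The lower bound depends on `m` only, so the
off-diagonal estimate remains summable over `k` with `j = nk`. -/
theorem one_div_le_abs_log_sub_log {m j : ℕ} (hm : 1 ≤ m) (hj : 1 ≤ j) (h : j ≠ m) :
    1 / ((m : ℝ) + 1) ≤ |Real.log m - Real.log j| := by
  have hm0 : (1 : ℝ) ≤ m := by exact_mod_cast hm
  have hj0 : (1 : ℝ) ≤ j := by exact_mod_cast hj
  rcases lt_or_gt_of_ne h with h | h
  · have h' : (j : ℝ) + 1 ≤ m := by exact_mod_cast h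
    refine le_trans ?_ (le_abs_self _)
    rw [← Real.log_div (by positivity) (by positivity)]
    refine le_trans ?_ (Real.one_sub_inv_le_log_of_pos (by positivity))
    rw [inv_div, one_sub_div (by positivity), div_le_div_iff₀ (by positivity) (by positivity)]
    nlinarith
  · have h' : (m : ℝ) + 1 ≤ j := by exact_mod_cast h
    rw [abs_sub_comm]
    refine le_trans ?_ (le_abs_self _)
    rw [← Real.log_div (by positivity) (by positivity)]
    refine le_trans ?_ (Real.one_sub_inv_le_log_of_pos (by positivity))
    rw [inv_div, one_sub_div (by positivity), div_le_div_iff₀ (by positivity) (by positivity)]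
    nlinarith

theorem natCast_cpow_eq_ofReal_mul_exp {n : ℕ} (hn : 1 ≤ n) (x y : ℝ) :
    (n : ℂ) ^ (x + Complex.I * y : ℂ) = ((n : ℝ) ^ x : ℝ) * Complex.exp (Complex.I * y * Real.log n) := by
  have hn0 : (n : ℂ) ≠ 0 := by exact_mod_cast (by omega : n ≠ 0)
  rw [Complex.cpow_add _ _ hn0, Complex.ofReal_cpow (by positivity), Complex.cpow_def_of_ne_zero hn0
    (Complex.I * y), Complex.ofReal_natCast, ← Complex.natCast_log]
  congr 2
  ring

/-- The twisted integral of a single term of the Dirichlet series of `ζ` on the line `Re s = c`. -/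
theorem norm_integral_twist_sub_le {c : ℝ} {m n k : ℕ} (hm : 1 ≤ m) (hn : 1 ≤ n) (hk : 1 ≤ k)
    (T : ℝ) :
    ‖(∫ t in T..(2 * T), (k : ℂ) ^ (-(c + Complex.I * t : ℂ)) * (m : ℂ) ^ ((c + Complex.I * t : ℂ) - 1)
        * (n : ℂ) ^ (-(c + Complex.I * t : ℂ))) - (if n * k = m then (T / m : ℂ) else 0)‖
      ≤ 4 * (m : ℝ) ^ c * (n : ℝ) ^ (-c) * (k : ℝ) ^ (-c) := by
  have hm0 : (1 : ℝ) ≤ m := by exact_mod_cast hm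
  have hn0 : (1 : ℝ) ≤ n := by exact_mod_cast hn
  have hk0 : (1 : ℝ) ≤ k := by exact_mod_cast hk
  set l : ℝ := Real.log m - Real.log (n * k : ℕ) with hl
  set K : ℝ := (k : ℝ) ^ (-c) * (m : ℝ) ^ (c - 1) * (n : ℝ) ^ (-c) with hK
  have hK0 : 0 ≤ K := by positivity
  have hint : ∀ t : ℝ, (k : ℂ) ^ (-(c + Complex.I * t : ℂ)) * (m : ℂ) ^ ((c + Complex.I * t : ℂ) - 1)
        * (n : ℂ) ^ (-(c + Complex.I * t : ℂ)) = K * Complex.exp (l * Complex.I * t) := by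
    intro t
    have e1 : (-(c + Complex.I * t) : ℂ) = ((-c : ℝ) : ℂ) + Complex.I * ((-t : ℝ) : ℂ) := by
      push_cast; ring
    have e2 : ((c + Complex.I * t : ℂ) - 1) = ((c - 1 : ℝ) : ℂ) + Complex.I * ((t : ℝ) : ℂ) := by
      push_cast; ring
    rw [e1, e2, natCast_cpow_eq_ofReal_mul_exp hk, natCast_cpow_eq_ofReal_mul_exp hm,
      natCast_cpow_eq_ofReal_mul_exp hn, hK, hl, Nat.cast_mul,
      Real.log_mul (by positivity) (by positivity)]
    have e3 : (((Real.log m - (Real.log n + Real.log k) : ℝ) : ℂ) * Complex.I * t)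
        = Complex.I * ((-t : ℝ) : ℂ) * Real.log k + Complex.I * t * Real.log m
          + Complex.I * ((-t : ℝ) : ℂ) * Real.log n := by
      push_cast; ring
    rw [e3, Complex.exp_add, Complex.exp_add]
    push_cast
    ring
  simp_rw [hint]
  rw [intervalIntegral.integral_const_mul]
  split_ifs with h
  · have hl0 : l = 0 := by rw [hl, h, sub_self]
    have hKm : K = 1 / m := by
      have : (k : ℝ) ^ (-c) * (n : ℝ) ^ (-c) = (m : ℝ) ^ (-c) := by
        rw [← Real.mul_rpow (by positivity) (by positivity), ← h]
        push_cast
        rw [mul_comm]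
      rw [hK, mul_right_comm, this, ← Real.rpow_add (by positivity)]
      rw [show -c + (c - 1) = -1 by ring, Real.rpow_neg_one, one_div]
    have : (K : ℂ) * ∫ t in T..(2 * T), Complex.exp (l * Complex.I * t) = T / m := by
      rw [hl0, hKm]
      simp
      ring
    rw [this, sub_self, norm_zero]
    positivity
  · have hnk : 1 ≤ n * k := Nat.mul_pos hn hk
    have hlow := one_div_le_abs_log_sub_log hm hnk h
    have hl0 : 0 < |l| := lt_of_lt_of_le (by positivity) hlow
    rw [sub_zero, norm_mul, Complex.norm_real, Real.norm_of_nonneg hK0]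
    calc K * _ ≤ K * (2 / |l|) := mul_le_mul_of_nonneg_left
          (norm_integral_exp_mul_I_le (abs_pos.1 hl0) _ _) hK0
      -- Here `1/|l| ≤ m + 1 ≤ 2m`.
      _ ≤ K * (4 * m) := by
          refine mul_le_mul_of_nonneg_left ?_ hK0
          rw [div_le_iff₀ hl0]
          rw [div_le_iff₀ (by positivity)] at hlow
          nlinarith
      _ = _ := by
          rw [hK, show (m : ℝ) ^ c = (m : ℝ) ^ (c - 1) * m by
            rw [← Real.rpow_add_one (by positivity)]; congr 1; ring]
          ring

/-- Absolute convergence for `c > 1` allows termwise integration. The only diagonal index is `k =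
m/n`, present exactly when `n ∣ m`. -/
theorem norm_integral_riemannZeta_twist_sub_le {c : ℝ} (hc : 1 < c) {m n : ℕ} (hm : 1 ≤ m)
    (hn : 1 ≤ n) (T : ℝ) :
    ‖(∫ t in T..(2 * T), riemannZeta (c + Complex.I * t) * (m : ℂ) ^ ((c + Complex.I * t : ℂ) - 1)
        * (n : ℂ) ^ (-(c + Complex.I * t : ℂ))) - (if n ∣ m then (T / m : ℂ) else 0)‖
      ≤ 4 * (m : ℝ) ^ c * (n : ℝ) ^ (-c) * ∑' k : ℕ, (k : ℝ) ^ (-c) := by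
  have hsum : Summable fun k : ℕ => (k : ℝ) ^ (-c) := Real.summable_nat_rpow.2 (by linarith)
  have hc0 : ∀ t : ℝ, (c + Complex.I * t : ℂ).re = c := fun t => by simp
  have hne : ∀ t : ℝ, -(c + Complex.I * t : ℂ) ≠ 0 := fun t h => by
    have := hc0 t
    rw [neg_eq_zero.1 h] at this
    simp at this
    linarith
  set G : ℕ → ℝ → ℂ := fun k t => (k : ℂ) ^ (-(c + Complex.I * t : ℂ))
    * (m : ℂ) ^ ((c + Complex.I * t : ℂ) - 1) * (n : ℂ) ^ (-(c + Complex.I * t : ℂ)) with hG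
  have hm0 : (m : ℂ) ≠ 0 := by exact_mod_cast (by omega : m ≠ 0)
  have hGc : ∀ k, Continuous (G k) := fun k =>
    (((by fun_prop : Continuous fun t : ℝ => -(c + Complex.I * t : ℂ)).const_cpow
      (Or.inr hne)).mul ((by fun_prop : Continuous fun t : ℝ => (c + Complex.I * t : ℂ) - 1).const_cpow
      (Or.inl hm0))).mul ((by fun_prop : Continuous fun t : ℝ => -(c + Complex.I * t : ℂ)).const_cpow
      (Or.inr hne))
  have hnorm : ∀ k t, ‖G k t‖ = (k : ℝ) ^ (-c) * ((m : ℝ) ^ (c - 1) * (n : ℝ) ^ (-c)) := by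
    intro k t
    have hk : ‖(k : ℂ) ^ (-(c + Complex.I * t : ℂ))‖ = (k : ℝ) ^ (-c) := by
      rcases Nat.eq_zero_or_pos k with rfl | hk
      · rw [Nat.cast_zero, Complex.zero_cpow (hne t), Nat.cast_zero, Real.zero_rpow (by linarith),
          norm_zero]
      · rw [Complex.norm_natCast_cpow_of_pos hk]; simp
    rw [hG]
    simp only [norm_mul]
    rw [hk, Complex.norm_natCast_cpow_of_pos (by omega), Complex.norm_natCast_cpow_of_pos (by omega)]
    simp [mul_assoc]
  have hH : HasSum (fun k => ∫ t in T..(2 * T), G k t) (∫ t in T..(2 * T),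
      riemannZeta (c + Complex.I * t) * (m : ℂ) ^ ((c + Complex.I * t : ℂ) - 1)
        * (n : ℂ) ^ (-(c + Complex.I * t : ℂ))) := by
    refine intervalIntegral.hasSum_integral_of_dominated_convergence
      (fun k _ => (k : ℝ) ^ (-c) * ((m : ℝ) ^ (c - 1) * (n : ℝ) ^ (-c)))
      (fun k => (hGc k).aestronglyMeasurable) (fun k => MeasureTheory.ae_of_all _ fun t _ => (hnorm k t).le)
      (MeasureTheory.ae_of_all _ fun t _ => hsum.mul_right ((m : ℝ) ^ (c - 1) * (n : ℝ) ^ (-c))) intervalIntegrable_const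
      (MeasureTheory.ae_of_all _ fun t _ => ?_)
    refine HasSum.mul_right _ (HasSum.mul_right _ ?_)
    rw [zeta_eq_tsum_one_div_nat_cpow (s := c + Complex.I * t) (by rw [hc0]; exact hc)]
    simp_rw [one_div, ← Complex.cpow_neg]
    refine Summable.hasSum ?_
    simpa only [Complex.cpow_neg, one_div] using
      (Complex.summable_one_div_nat_cpow (p := c + Complex.I * t)).2 (by rw [hc0]; exact hc)
  have hdiag : HasSum (fun k : ℕ => if n * k = m then (T / m : ℂ) else 0)
      (if n ∣ m then (T / m : ℂ) else 0) := by
    by_cases h : n ∣ m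
    · obtain ⟨j, rfl⟩ := h
      have hn' : 0 < n := hn
      simp only [Nat.mul_right_inj hn'.ne', dvd_mul_right, if_true]
      exact hasSum_ite_eq j _
    · rw [if_neg h]
      convert hasSum_zero with k
      rw [if_neg]
      rintro rfl
      exact h (dvd_mul_right _ _)
  rw [← (hH.sub hdiag).tsum_eq]
  refine tsum_of_norm_bounded (hsum.hasSum.mul_left _) fun k => ?_
  rcases Nat.eq_zero_or_pos k with rfl | hk
  · have hz : ∀ t, G 0 t = 0 := fun t => by
      rw [← norm_eq_zero, hnorm, Nat.cast_zero, Real.zero_rpow (by linarith), zero_mul]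
    simp only [hz]
    rw [if_neg (by omega)]
    simp only [intervalIntegral.integral_zero, sub_zero, norm_zero]
    positivity
  · exact norm_integral_twist_sub_le hm hn hk T

/-! ### Shifting the contour -/

/-- For `σ ≤ 1` the exponents are nonnegative with sum `1`; beyond that the second factor is at most
`1`. Extracting this power leaves the weights `|a m|/m` and `|b n|/n`, whose sums are only
logarithmic. -/
theorem natCast_rpow_mul_rpow_le {m n N : ℕ} (hm : m ∈ Finset.Icc 1 N) (hn : n ∈ Finset.Icc 1 N)
    {σ c : ℝ} (h0 : 0 ≤ σ) (h1 : σ ≤ c) (hc : 1 ≤ c) :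
    (m : ℝ) ^ σ * (n : ℝ) ^ (1 - σ) ≤ (N : ℝ) ^ c := by
  obtain ⟨hm1, hmN⟩ := Finset.mem_Icc.1 hm
  obtain ⟨hn1, hnN⟩ := Finset.mem_Icc.1 hn
  have hm1 : (1 : ℝ) ≤ m := by exact_mod_cast hm1
  have hn1 : (1 : ℝ) ≤ n := by exact_mod_cast hn1
  have hmN : (m : ℝ) ≤ N := by exact_mod_cast hmN
  have hnN : (n : ℝ) ≤ N := by exact_mod_cast hnN
  have hN1 : (1 : ℝ) ≤ N := hm1.trans hmN
  have e1 : (m : ℝ) ^ σ ≤ (N : ℝ) ^ σ := Real.rpow_le_rpow (by linarith) hmN h0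
  rcases le_total σ 1 with h | h
  · have e2 : (n : ℝ) ^ (1 - σ) ≤ (N : ℝ) ^ (1 - σ) :=
      Real.rpow_le_rpow (by linarith) hnN (by linarith)
    calc _ ≤ (N : ℝ) ^ σ * (N : ℝ) ^ (1 - σ) := by gcongr
      _ = (N : ℝ) ^ (1 : ℝ) := by rw [← Real.rpow_add (by linarith)]; congr 1; ring
      _ ≤ _ := Real.rpow_le_rpow_of_exponent_le hN1 hc
  · have e2 : (n : ℝ) ^ (1 - σ) ≤ 1 := Real.rpow_le_one_of_one_le_of_nonpos hn1 (by linarith)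
    calc _ ≤ (N : ℝ) ^ σ * 1 := by gcongr
      _ = (N : ℝ) ^ σ := mul_one _
      _ ≤ _ := Real.rpow_le_rpow_of_exponent_le hN1 h1

/-- A pair of Dirichlet polynomials at `1 - s` and `s`, bounded in the strip `0 ≤ Re s ≤ c`. -/
theorem norm_dirichletSum_mul_le (a b : ℕ → ℝ) (N : ℕ) {c : ℝ} (hc : 1 ≤ c) {s : ℂ}
    (h0 : 0 ≤ s.re) (h1 : s.re ≤ c) :
    ‖(∑ m ∈ Finset.Icc 1 N, (a m : ℂ) / (m : ℂ) ^ (1 - s))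
        * ∑ n ∈ Finset.Icc 1 N, (b n : ℂ) / (n : ℂ) ^ s‖
      ≤ (N : ℝ) ^ c * ((∑ m ∈ Finset.Icc 1 N, |a m| / m) * ∑ n ∈ Finset.Icc 1 N, |b n| / n) := by
  rw [Finset.sum_mul_sum, Finset.sum_mul_sum, Finset.mul_sum]
  refine (norm_sum_le _ _).trans (Finset.sum_le_sum fun m hm => ?_)
  rw [Finset.mul_sum]
  refine (norm_sum_le _ _).trans (Finset.sum_le_sum fun n hn => ?_)
  have hm1 : 0 < m := (Finset.mem_Icc.1 hm).1
  have hn1 : 0 < n := (Finset.mem_Icc.1 hn).1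
  have hm0 : (0 : ℝ) < m := by exact_mod_cast hm1
  have hn0 : (0 : ℝ) < n := by exact_mod_cast hn1
  rw [norm_mul, norm_div, norm_div, Complex.norm_natCast_cpow_of_pos hm1,
    Complex.norm_natCast_cpow_of_pos hn1, Complex.norm_real, Complex.norm_real, Real.norm_eq_abs,
    Real.norm_eq_abs, Complex.sub_re, Complex.one_re]
  have key := natCast_rpow_mul_rpow_le hm hn h0 h1 hc
  calc |a m| / (m : ℝ) ^ (1 - s.re) * (|b n| / (n : ℝ) ^ s.re)
      = ((m : ℝ) ^ s.re * (n : ℝ) ^ (1 - s.re)) * (|a m| / m * (|b n| / n)) := by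
        rw [Real.rpow_sub hm0, Real.rpow_sub hn0, Real.rpow_one, Real.rpow_one]
        have := (Real.rpow_pos_of_pos hm0 s.re).ne'
        have := (Real.rpow_pos_of_pos hn0 s.re).ne'
        field_simp
    _ ≤ _ := by gcongr

theorem continuous_riemannZeta_vertical {c : ℝ} (hc : c ≠ 1) :
    Continuous fun t : ℝ => riemannZeta (c + Complex.I * t) := by
  rw [continuous_iff_continuousAt]
  intro t
  have : ContinuousAt riemannZeta (c + Complex.I * t) :=
    (differentiableAt_riemannZeta fun h => hc (by simpa using congrArg Complex.re h)).continuousAt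
  exact ContinuousAt.comp (f := fun t : ℝ => (c + Complex.I * t : ℂ)) this (by fun_prop)

/-- The moment on the line `Re s = c > 1`: only the diagonal terms contribute. -/
theorem norm_integral_right_line_sub_le (a b : ℕ → ℝ) (N : ℕ) {c : ℝ} (hc : 1 < c) (T : ℝ) :
    ‖(∫ t in T..(2 * T), riemannZeta (c + Complex.I * t)
        * (∑ m ∈ Finset.Icc 1 N, (a m : ℂ) / (m : ℂ) ^ (1 - (c + Complex.I * t : ℂ)))
        * ∑ n ∈ Finset.Icc 1 N, (b n : ℂ) / (n : ℂ) ^ (c + Complex.I * t : ℂ))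
      - T * ∑ m ∈ Finset.Icc 1 N, ∑ n ∈ Finset.Icc 1 N, (if n ∣ m then (a m * b n / m : ℂ) else 0)‖
      ≤ 4 * (∑' k : ℕ, (k : ℝ) ^ (-c)) * (N : ℝ) ^ (c + 1)
        * ((∑ m ∈ Finset.Icc 1 N, |a m| / m) * ∑ n ∈ Finset.Icc 1 N, |b n| / n) := by
  set Z := ∑' k : ℕ, (k : ℝ) ^ (-c)
  have hZ : 0 ≤ Z := tsum_nonneg fun _ => by positivity
  have e1 : ∀ t : ℝ, riemannZeta (c + Complex.I * t)
        * (∑ m ∈ Finset.Icc 1 N, (a m : ℂ) / (m : ℂ) ^ (1 - (c + Complex.I * t : ℂ)))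
        * ∑ n ∈ Finset.Icc 1 N, (b n : ℂ) / (n : ℂ) ^ (c + Complex.I * t : ℂ)
      = ∑ m ∈ Finset.Icc 1 N, ∑ n ∈ Finset.Icc 1 N, (a m * b n : ℂ) *
        (riemannZeta (c + Complex.I * t) * (m : ℂ) ^ ((c + Complex.I * t : ℂ) - 1)
          * (n : ℂ) ^ (-(c + Complex.I * t : ℂ))) := by
    intro t
    rw [mul_assoc, Finset.sum_mul_sum, Finset.mul_sum]
    refine Finset.sum_congr rfl fun m _ => ?_
    rw [Finset.mul_sum]
    refine Finset.sum_congr rfl fun n _ => ?_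
    rw [Complex.cpow_neg, show (c + Complex.I * t : ℂ) - 1 = -(1 - (c + Complex.I * t : ℂ)) by ring,
      Complex.cpow_neg]
    ring
  have hcont : ∀ m ∈ Finset.Icc 1 N, ∀ n ∈ Finset.Icc 1 N, Continuous fun t : ℝ =>
      (a m * b n : ℂ) * (riemannZeta (c + Complex.I * t) * (m : ℂ) ^ ((c + Complex.I * t : ℂ) - 1)
          * (n : ℂ) ^ (-(c + Complex.I * t : ℂ))) := by
    intro m hm n hn
    have hm0 : (m : ℂ) ≠ 0 := by
      have := (Finset.mem_Icc.1 hm).1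
      exact_mod_cast (by omega : m ≠ 0)
    have hn0 : (n : ℂ) ≠ 0 := by
      have := (Finset.mem_Icc.1 hn).1
      exact_mod_cast (by omega : n ≠ 0)
    refine continuous_const.mul (((continuous_riemannZeta_vertical hc.ne').mul ?_).mul ?_)
    · exact (by fun_prop : Continuous fun t : ℝ => (c + Complex.I * t : ℂ) - 1).const_cpow (Or.inl hm0)
    · exact (by fun_prop : Continuous fun t : ℝ => -(c + Complex.I * t : ℂ)).const_cpow (Or.inl hn0)
  simp_rw [e1]
  rw [intervalIntegral.integral_finsetSum fun m hm => (continuous_finsetSum _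
    fun n hn => hcont m hm n hn).intervalIntegrable _ _, Finset.mul_sum, ← Finset.sum_sub_distrib,
    Finset.sum_mul_sum, Finset.mul_sum]
  refine (norm_sum_le _ _).trans (Finset.sum_le_sum fun m hm => ?_)
  rw [intervalIntegral.integral_finsetSum fun n hn => (hcont m hm n hn).intervalIntegrable _ _,
    Finset.mul_sum, Finset.mul_sum, ← Finset.sum_sub_distrib]
  refine (norm_sum_le _ _).trans (Finset.sum_le_sum fun n hn => ?_)
  obtain ⟨hm1, hmN⟩ := Finset.mem_Icc.1 hm
  obtain ⟨hn1, hnN⟩ := Finset.mem_Icc.1 hn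
  have hmN' : (m : ℝ) ≤ N := by exact_mod_cast hmN
  have hm0 : (0 : ℝ) < m := by exact_mod_cast hm1
  have hn0 : (1 : ℝ) ≤ n := by exact_mod_cast hn1
  have key := norm_integral_riemannZeta_twist_sub_le hc hm1 hn1 T
  rw [intervalIntegral.integral_const_mul]
  have e2 : (T : ℂ) * (if n ∣ m then (a m * b n / m : ℂ) else 0)
      = (a m * b n : ℂ) * (if n ∣ m then (T / m : ℂ) else 0) := by
    split_ifs <;> ring
  rw [e2, ← mul_sub, norm_mul, norm_mul, Complex.norm_real, Complex.norm_real, Real.norm_eq_abs,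
    Real.norm_eq_abs]
  have e3 : (m : ℝ) ^ c = (m : ℝ) ^ (c + 1) / m := by
    rw [Real.rpow_add_one hm0.ne']; field_simp
  have e4 : (n : ℝ) ^ (-c) ≤ 1 / n := by
    rw [one_div, ← Real.rpow_neg_one]
    exact Real.rpow_le_rpow_of_exponent_le hn0 (by linarith)
  have e5 : (m : ℝ) ^ (c + 1) ≤ (N : ℝ) ^ (c + 1) := Real.rpow_le_rpow hm0.le hmN' (by linarith)
  calc _ ≤ |a m| * |b n| * (4 * (m : ℝ) ^ c * (n : ℝ) ^ (-c) * Z) := by gcongr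
    _ = |a m| * |b n| * (4 * ((m : ℝ) ^ (c + 1) / m) * (n : ℝ) ^ (-c) * Z) := by rw [e3]
    _ ≤ |a m| * |b n| * (4 * ((N : ℝ) ^ (c + 1) / m) * (1 / n) * Z) := by gcongr
    _ = _ := by ring

/-- Mean value of `ζ` on the critical line twisted by two Dirichlet polynomials. -/
theorem norm_twisted_moment_sub_le (a b : ℕ → ℝ) (N : ℕ) {c : ℝ} (hc : 1 < c) (hc2 : c ≤ 2)
    {T : ℝ} (hT : 1 ≤ T) :
    ‖(∫ t in T..(2 * T), riemannZeta (1 / 2 + Complex.I * t)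
        * (∑ m ∈ Finset.Icc 1 N, (a m : ℂ) / (m : ℂ) ^ (1 / 2 - Complex.I * t : ℂ))
        * ∑ n ∈ Finset.Icc 1 N, (b n : ℂ) / (n : ℂ) ^ (1 / 2 + Complex.I * t : ℂ))
      - T * ∑ m ∈ Finset.Icc 1 N, ∑ n ∈ Finset.Icc 1 N, (if n ∣ m then (a m * b n / m : ℂ) else 0)‖
      ≤ (180 * √T * (N : ℝ) ^ c + 4 * (∑' k : ℕ, (k : ℝ) ^ (-c)) * (N : ℝ) ^ (c + 1))
        * ((∑ m ∈ Finset.Icc 1 N, |a m| / m) * ∑ n ∈ Finset.Icc 1 N, |b n| / n) := by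
  set W := (∑ m ∈ Finset.Icc 1 N, |a m| / m) * ∑ n ∈ Finset.Icc 1 N, |b n| / n with hW
  have hW0 : 0 ≤ W := by positivity
  set F : ℂ → ℂ := fun s => riemannZeta s
    * (∑ m ∈ Finset.Icc 1 N, (a m : ℂ) / (m : ℂ) ^ (1 - s))
    * ∑ n ∈ Finset.Icc 1 N, (b n : ℂ) / (n : ℂ) ^ s with hF
  have hFd : DifferentiableOn ℂ F (Set.uIcc (1 / 2 : ℝ) c ×ℂ Set.uIcc T (2 * T)) := by
    intro s hs
    have him : T ≤ s.im := by
      have := hs.2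
      rw [Set.mem_preimage, Set.uIcc_of_le (by linarith)] at this
      exact this.1
    have hs1 : s ≠ 1 := by rintro rfl; simp at him; linarith
    refine DifferentiableAt.differentiableWithinAt (((differentiableAt_riemannZeta hs1).mul
      (DifferentiableAt.fun_sum fun m hm => ?_)).mul (DifferentiableAt.fun_sum fun n hn => ?_))
    · have hm0 : (m : ℂ) ≠ 0 := by
        have := (Finset.mem_Icc.1 hm).1
        exact_mod_cast (by omega : m ≠ 0)
      exact (differentiableAt_const _).div (DifferentiableAt.const_cpow (by fun_prop) (Or.inl hm0))
        (by simp [Complex.cpow_eq_zero_iff, hm0])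
    · have hn0 : (n : ℂ) ≠ 0 := by
        have := (Finset.mem_Icc.1 hn).1
        exact_mod_cast (by omega : n ≠ 0)
      exact (differentiableAt_const _).div (DifferentiableAt.const_cpow (by fun_prop) (Or.inl hn0))
        (by simp [Complex.cpow_eq_zero_iff, hn0])
  -- The rectangle from `1/2 + iT` to `c + 2iT` excludes the pole at `1`, so no residue appears.
  have hrect := Complex.integral_boundary_rect_eq_zero_of_differentiableOn F
    ⟨1 / 2, T⟩ ⟨c, 2 * T⟩ hFd
  simp only [smul_eq_mul] at hrect
  have hhor : ∀ U : ℝ, 1 ≤ U → U ≤ 2 * T →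
      ‖∫ x in (1 / 2 : ℝ)..c, F (x + U * Complex.I)‖ ≤ 90 * √T * (N : ℝ) ^ c * W := by
    intro U hU hUT
    -- The factor `60` is `30 · 2`, from `√U ≤ 2√T`; the side length is at most `3/2`, whence `90`,
    -- and the two sides together give `180`.
    refine (intervalIntegral.norm_integral_le_of_norm_le_const
      (C := 60 * √T * (N : ℝ) ^ c * W) fun x hx => ?_).trans ?_
    · rw [Set.uIoc_of_le (by linarith)] at hx
      have hre : (x + U * Complex.I : ℂ).re = x := by simp
      have him : (x + U * Complex.I : ℂ).im = U := by simp
      have h1 := norm_riemannZeta_le_sqrt (s := x + U * Complex.I) (by rw [hre]; exact hx.1.le)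
        (by rw [hre]; linarith [hx.2]) (by rwa [him])
      rw [him] at h1
      have h2 := norm_dirichletSum_mul_le a b N hc.le (s := x + U * Complex.I)
        (by rw [hre]; linarith [hx.1]) (by rw [hre]; exact hx.2)
      have h3 : √U ≤ 2 * √T := by
        rw [Real.sqrt_le_left (by positivity), mul_pow, Real.sq_sqrt (by linarith)]
        linarith
      rw [hF]
      simp only [mul_assoc]
      rw [norm_mul]
      calc _ ≤ (30 * √U) * ((N : ℝ) ^ c * W) := by gcongr
        _ ≤ (30 * (2 * √T)) * ((N : ℝ) ^ c * W) := by gcongr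
        _ = _ := by ring
    · rw [abs_of_nonneg (by linarith)]
      have : 0 ≤ 60 * √T * (N : ℝ) ^ c * W := by positivity
      nlinarith
  have hb := hhor T hT (by linarith)
  have ht := hhor (2 * T) (by linarith) le_rfl
  have hr := norm_integral_right_line_sub_le a b N hc T
  have eL : (∫ t in T..(2 * T), riemannZeta (1 / 2 + Complex.I * t)
        * (∑ m ∈ Finset.Icc 1 N, (a m : ℂ) / (m : ℂ) ^ (1 / 2 - Complex.I * t : ℂ))
        * ∑ n ∈ Finset.Icc 1 N, (b n : ℂ) / (n : ℂ) ^ (1 / 2 + Complex.I * t : ℂ))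
      = ∫ t in T..(2 * T), F (((1 / 2 : ℝ) : ℂ) + t * Complex.I) := by
    refine intervalIntegral.integral_congr fun t _ => ?_
    simp only [hF]
    have x1 : ((1 / 2 : ℝ) : ℂ) + t * Complex.I = 1 / 2 + Complex.I * t := by push_cast; ring
    have x2 : (1 - (1 / 2 + Complex.I * t) : ℂ) = 1 / 2 - Complex.I * t := by ring
    rw [x1, x2]
  have eR : (∫ t in T..(2 * T), riemannZeta (c + Complex.I * t)
        * (∑ m ∈ Finset.Icc 1 N, (a m : ℂ) / (m : ℂ) ^ (1 - (c + Complex.I * t : ℂ)))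
        * ∑ n ∈ Finset.Icc 1 N, (b n : ℂ) / (n : ℂ) ^ (c + Complex.I * t : ℂ))
      = ∫ t in T..(2 * T), F (c + t * Complex.I) := by
    refine intervalIntegral.integral_congr fun t _ => ?_
    simp only [hF]
    rw [mul_comm Complex.I]
  rw [eR] at hr
  rw [eL]
  set J0 := ∫ t in T..(2 * T), F (((1 / 2 : ℝ) : ℂ) + t * Complex.I)
  set J1 := ∫ t in T..(2 * T), F (c + t * Complex.I)
  set B0 := ∫ x in (1 / 2 : ℝ)..c, F (x + T * Complex.I)
  set B1 := ∫ x in (1 / 2 : ℝ)..c, F (x + (2 * T : ℝ) * Complex.I)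
  set D := (T : ℂ) * ∑ m ∈ Finset.Icc 1 N, ∑ n ∈ Finset.Icc 1 N,
    (if n ∣ m then (a m * b n / m : ℂ) else 0)
  have e : J0 - D = (J1 - D) + (-Complex.I * B0 + Complex.I * B1) := by
    linear_combination Complex.I * hrect - (J1 - J0) * Complex.I_sq
  rw [e]
  refine (norm_add_le _ _).trans ?_
  have h4 : ‖-Complex.I * B0 + Complex.I * B1‖ ≤ ‖B0‖ + ‖B1‖ := by
    refine (norm_add_le _ _).trans ?_
    simp
  rw [add_mul]
  linarith

/-! ### Reduction of the moment to the diagonal -/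

/-- The diagonal contribution to the cross moment. -/
noncomputable def diagonalSum (r : ℕ) (P₁ P₂ : ℝ[X]) (y : ℝ) : ℝ :=
  ∑ m ∈ Finset.Icc 1 ⌊y⌋₊, ∑ n ∈ Finset.Icc 1 ⌊y⌋₊,
    if n ∣ m then ((divisorFn (r + 1) m : ℝ) * smoothWeight P₁ y m)
      * ((divisorFn r n : ℝ) * smoothWeight P₂ y n) / m else 0

theorem exists_abs_smoothWeight_le (P : ℝ[X]) : ∃ M : ℝ, 0 ≤ M ∧ ∀ y : ℝ, 1 < y →
    ∀ n ∈ Finset.Icc 1 ⌊y⌋₊, |smoothWeight P y n| ≤ M := by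
  obtain ⟨M, hM⟩ := (isCompact_Icc (a := (0 : ℝ)) (b := 1)).exists_bound_of_continuousOn
    (f := fun x => P.eval x) P.continuous.continuousOn
  refine ⟨M, (norm_nonneg _).trans (hM 0 (by simp)), fun y hy n hn => hM _ ?_⟩
  obtain ⟨h1, h2⟩ := Finset.mem_Icc.1 hn
  have hn1 : (1 : ℝ) ≤ n := by exact_mod_cast h1
  have hny : (n : ℝ) ≤ y := (Nat.le_floor_iff (by linarith)).1 h2
  have hl := Real.log_pos hy
  have hn0 := Real.log_nonneg hn1
  have hny' := Real.log_le_log (by linarith) hny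
  rw [Real.log_div (by linarith) (by linarith)]
  exact ⟨div_nonneg (by linarith) hl.le, (div_le_one hl).2 (by linarith)⟩

theorem sum_abs_divisorFn_mul_le {w : ℕ → ℝ} {M y : ℝ} (hy : 1 ≤ y) (k : ℕ)
    (hM : 0 ≤ M) (h : ∀ n ∈ Finset.Icc 1 ⌊y⌋₊, |w n| ≤ M) :
    ∑ n ∈ Finset.Icc 1 ⌊y⌋₊, |(divisorFn k n : ℝ) * w n| / n ≤ M * (1 + Real.log y) ^ k := by
  refine le_trans ?_ (mul_le_mul_of_nonneg_left (sum_divisorFn_div_le k hy) hM)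
  rw [Finset.mul_sum]
  refine Finset.sum_le_sum fun n hn => ?_
  rw [abs_mul, Nat.abs_cast, ← mul_div_assoc, mul_comm M]
  have := h n hn
  gcongr

theorem isLittleO_rpow_mul_log_pow {e θ : ℝ} (he : e < 1) (j : ℕ) :
    (fun T : ℝ => T ^ e * (1 + θ * Real.log T) ^ j) =o[atTop] fun T : ℝ => T := by
  have h1 : (fun T : ℝ => 1 + θ * Real.log T) =O[atTop] fun T => Real.log T := by
    refine IsBigO.add ?_ (isBigO_const_mul_self θ _ _)
    exact (isLittleO_const_left.2 (Or.inr (tendsto_norm_atTop_atTop.comp Real.tendsto_log_atTop))).isBigO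
  have h2 : (fun T : ℝ => (1 + θ * Real.log T) ^ j) =o[atTop] fun T => T ^ (1 - e) := by
    refine (h1.pow j).trans_isLittleO ?_
    have := isLittleO_log_rpow_rpow_atTop (j : ℝ) (by linarith : 0 < 1 - e)
    simpa using this
  refine ((isBigO_refl (fun T : ℝ => T ^ e) atTop).mul_isLittleO h2).congr' EventuallyEq.rfl ?_
  filter_upwards [eventually_gt_atTop 0] with T hT
  rw [← Real.rpow_add hT, add_sub_cancel, Real.rpow_one]

/-- Only the diagonal contributes to the cross moment. -/
theorem crossMoment_sub_diagonal_isLittleO (r : ℕ) {θ : ℝ} (hθ₀ : 0 < θ) (hθ₁ : θ < 1 / 2)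
    (P₁ P₂ : ℝ[X]) :
    (fun T : ℝ => crossMoment r θ P₁ P₂ T - ((T * diagonalSum r P₁ P₂ (T ^ θ) : ℝ) : ℂ))
      =o[atTop] fun T : ℝ => T := by
  obtain ⟨M₁, hM₁, h₁⟩ := exists_abs_smoothWeight_le P₁
  obtain ⟨M₂, hM₂, h₂⟩ := exists_abs_smoothWeight_le P₂
  -- This is where `θ < 1/2` enters: it leaves room for `c > 1` with `θc < 1/2`, so that both error
  -- exponents `1/2 + θc` and `θ(c+1)` are below `1`.
  obtain ⟨c, hc1, hc2⟩ : ∃ c : ℝ, 1 < c ∧ c < min 2 (1 / (2 * θ)) := by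
    refine exists_between (lt_min (by norm_num) ?_)
    rw [lt_div_iff₀ (by linarith)]
    linarith
  obtain ⟨hc2, hc3⟩ := lt_min_iff.1 hc2
  have hθc : θ * c < 1 / 2 := by
    rw [lt_div_iff₀ (by linarith)] at hc3
    linarith
  set Z := ∑' k : ℕ, (k : ℝ) ^ (-c)
  have hZ : 0 ≤ Z := tsum_nonneg fun _ => by positivity
  have hO : (fun T : ℝ => crossMoment r θ P₁ P₂ T - ((T * diagonalSum r P₁ P₂ (T ^ θ) : ℝ) : ℂ))
      =O[atTop] fun T : ℝ => (180 * M₁ * M₂) * (T ^ (1 / 2 + θ * c) * (1 + θ * Real.log T) ^ (r + 1 + r))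
        + (4 * Z * M₁ * M₂) * (T ^ (θ * (c + 1)) * (1 + θ * Real.log T) ^ (r + 1 + r)) := by
    refine IsBigO.of_bound 1 ?_
    filter_upwards [eventually_gt_atTop 1] with T hT
    have hT0 : 0 < T := by linarith
    have hy : 1 < T ^ θ := Real.one_lt_rpow hT hθ₀
    have hlog : Real.log (T ^ θ) = θ * Real.log T := Real.log_rpow hT0 θ
    have hlog0 : 0 ≤ θ * Real.log T := mul_nonneg hθ₀.le (Real.log_nonneg hT.le)
    have hmain := norm_twisted_moment_sub_le
      (fun m => (divisorFn (r + 1) m : ℝ) * smoothWeight P₁ (T ^ θ) m)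
      (fun n => (divisorFn r n : ℝ) * smoothWeight P₂ (T ^ θ) n) ⌊T ^ θ⌋₊ hc1 hc2.le hT.le
    have hA := sum_abs_divisorFn_mul_le hy.le (r + 1) hM₁ (h₁ _ hy)
    have hB := sum_abs_divisorFn_mul_le hy.le r hM₂ (h₂ _ hy)
    have eq : crossMoment r θ P₁ P₂ T - ((T * diagonalSum r P₁ P₂ (T ^ θ) : ℝ) : ℂ)
        = (∫ t in T..(2 * T), riemannZeta (1 / 2 + Complex.I * t)
        * (∑ m ∈ Finset.Icc 1 ⌊T ^ θ⌋₊, (((divisorFn (r + 1) m : ℝ) * smoothWeight P₁ (T ^ θ) m : ℝ) : ℂ)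
            / (m : ℂ) ^ (1 / 2 - Complex.I * t : ℂ))
        * ∑ n ∈ Finset.Icc 1 ⌊T ^ θ⌋₊, (((divisorFn r n : ℝ) * smoothWeight P₂ (T ^ θ) n : ℝ) : ℂ)
            / (n : ℂ) ^ (1 / 2 + Complex.I * t : ℂ))
      - T * ∑ m ∈ Finset.Icc 1 ⌊T ^ θ⌋₊, ∑ n ∈ Finset.Icc 1 ⌊T ^ θ⌋₊, (if n ∣ m then
        ((((divisorFn (r + 1) m : ℝ) * smoothWeight P₁ (T ^ θ) m : ℝ) : ℂ)
          * (((divisorFn r n : ℝ) * smoothWeight P₂ (T ^ θ) n : ℝ) : ℂ) / m : ℂ) else 0) := by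
      congr 1
      rw [diagonalSum]
      push_cast
      congr 1
      refine Finset.sum_congr rfl fun m _ => Finset.sum_congr rfl fun n _ => ?_
      split_ifs <;> push_cast <;> rfl
    rw [eq, one_mul]
    refine hmain.trans ((le_trans ?_ (le_abs_self _)))
    have hN : ((⌊T ^ θ⌋₊ : ℕ) : ℝ) ≤ T ^ θ := Nat.floor_le (by positivity)
    have e1 : ((⌊T ^ θ⌋₊ : ℕ) : ℝ) ^ c ≤ T ^ (θ * c) := by
      rw [Real.rpow_mul hT0.le]
      exact Real.rpow_le_rpow (by positivity) hN (by linarith)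
    have e2 : ((⌊T ^ θ⌋₊ : ℕ) : ℝ) ^ (c + 1) ≤ T ^ (θ * (c + 1)) := by
      rw [Real.rpow_mul hT0.le]
      exact Real.rpow_le_rpow (by positivity) hN (by linarith)
    rw [hlog] at hA hB
    calc _ ≤ (180 * √T * T ^ (θ * c) + 4 * Z * T ^ (θ * (c + 1))) *
          ((M₁ * (1 + θ * Real.log T) ^ (r + 1)) * (M₂ * (1 + θ * Real.log T) ^ r)) := by
          gcongr
      _ = _ := by
          rw [Real.rpow_add hT0, Real.sqrt_eq_rpow, pow_add _ (r + 1) r]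
          ring
  refine hO.trans_isLittleO (IsLittleO.add ?_ ?_)
  · exact (isLittleO_rpow_mul_log_pow (by linarith) _).const_mul_left _
  · exact (isLittleO_rpow_mul_log_pow (by nlinarith) _).const_mul_left _

/-! ### Local factors of the double Dirichlet series -/

/-- The terms of the local factor at `p` of the double Dirichlet series
`∑ d_{r+1}(kn) d_r(n) k^{-1-s} n^{-1-w}`, where `x = p^{-1-s}` and `z = p^{-1-w}`. -/
noncomputable def localTerm (r p : ℕ) (x z : ℝ) (e : ℕ) : ℝ :=
  divisorFn (r + 1) (p ^ e) * ∑ j ∈ Finset.range (e + 1), x ^ (e - j) * (divisorFn r (p ^ j) * z ^ j)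

/-- The local factor at `p` normalized by those of `ζ(1+s)^{r+1} ζ(1+w)^{r(r+1)}`. -/
noncomputable def localFactor (r p : ℕ) (x z : ℝ) : ℝ :=
  (∑' e, localTerm r p x z e) * ((1 - x) ^ (r + 1) * (1 - z) ^ (r * (r + 1)))

theorem localTerm_nonneg (r p : ℕ) {x z : ℝ} (hx : 0 ≤ x) (hz : 0 ≤ z) (e : ℕ) :
    0 ≤ localTerm r p x z e := by
  unfold localTerm
  positivity

/-- Replacing `x` and `z` by `ρ` collapses the inner sum to `d_{r+1}(p^e) ρ^e`, because `d_{r+1}` is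
the divisor sum of `d_r`. -/
theorem localTerm_le (r : ℕ) {p : ℕ} (hp : p.Prime) {x z ρ : ℝ} (hx : 0 ≤ x) (hz : 0 ≤ z)
    (hxρ : x ≤ ρ) (hzρ : z ≤ ρ) (e : ℕ) :
    localTerm r p x z e ≤ ((e : ℝ) + 1) ^ (2 * (r + 1)) * ρ ^ e := by
  have hρ : 0 ≤ ρ := hx.trans hxρ
  have h1 : (divisorFn (r + 1) (p ^ e) : ℝ) ≤ ((e : ℝ) + 1) ^ (r + 1) := by
    exact_mod_cast divisorFn_prime_pow_le (r + 1) hp e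
  have h2 : ∑ j ∈ Finset.range (e + 1), x ^ (e - j) * (divisorFn r (p ^ j) * z ^ j)
      ≤ divisorFn (r + 1) (p ^ e) * ρ ^ e := by
    rw [divisorFn_succ, Nat.sum_divisors_prime_pow hp, Nat.cast_sum, Finset.sum_mul]
    refine Finset.sum_le_sum fun j hj => ?_
    have hj : j ≤ e := by simpa [Nat.lt_succ_iff] using hj
    calc x ^ (e - j) * (divisorFn r (p ^ j) * z ^ j)
        ≤ ρ ^ (e - j) * (divisorFn r (p ^ j) * ρ ^ j) := by gcongr
      _ = divisorFn r (p ^ j) * ρ ^ e := by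
        rw [← Nat.sub_add_cancel hj, pow_add]
        simp
        ring
  calc localTerm r p x z e ≤ divisorFn (r + 1) (p ^ e) * (divisorFn (r + 1) (p ^ e) * ρ ^ e) :=
        mul_le_mul_of_nonneg_left h2 (by positivity)
    _ ≤ ((e : ℝ) + 1) ^ (r + 1) * (((e : ℝ) + 1) ^ (r + 1) * ρ ^ e) := by gcongr
    _ = _ := by ring

theorem summable_add_pow_mul_half_pow (k c : ℕ) :
    Summable fun e : ℕ => ((e : ℝ) + c) ^ k * (1 / 2 : ℝ) ^ e := by
  have h := summable_pow_mul_geometric_of_norm_lt_one k (r := (1 / 2 : ℝ)) (by norm_num)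
  have h2 := ((summable_nat_add_iff c).2 h).mul_left ((1 / 2 : ℝ) ^ c)⁻¹
  refine h2.congr fun e => ?_
  push_cast
  rw [pow_add]
  field_simp

theorem summable_localTerm (r : ℕ) {p : ℕ} (hp : p.Prime) {x z : ℝ} (hx : 0 ≤ x) (hz : 0 ≤ z)
    (hx2 : x ≤ 1 / 2) (hz2 : z ≤ 1 / 2) : Summable (localTerm r p x z) :=
  Summable.of_nonneg_of_le (localTerm_nonneg r p hx hz)
    (fun e => by simpa using localTerm_le r hp hx hz hx2 hz2 e)
    (summable_add_pow_mul_half_pow (2 * (r + 1)) 1)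

/-- The terms `e = 0, 1` give the linear polynomial exactly, as `d_{r+1}(p) = r+1` and `d_r(p) = r`.
These coefficients dictate the zeta exponents `r+1` and `r(r+1)`. -/
theorem abs_tsum_localTerm_sub_le (r : ℕ) : ∃ C : ℝ, 0 ≤ C ∧ ∀ p : ℕ, p.Prime → ∀ x z ρ : ℝ,
    0 ≤ x → 0 ≤ z → x ≤ ρ → z ≤ ρ → ρ ≤ 1 / 2 →
    |∑' e, localTerm r p x z e - (1 + ((r + 1 : ℕ) : ℝ) * x + ((r * (r + 1) : ℕ) : ℝ) * z)| ≤ C * ρ ^ 2 := by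
  -- After shifting by two terms, `ρ²` factors out and the remaining `ρ^e` is at most `2^{-e}`, so
  -- the constant is independent of `p`.
  refine ⟨∑' e : ℕ, ((e : ℝ) + 3) ^ (2 * (r + 1)) * (1 / 2 : ℝ) ^ e,
    tsum_nonneg fun _ => by positivity, fun p hp x z ρ hx hz hxρ hzρ hρ => ?_⟩
  have hρ0 : 0 ≤ ρ := hx.trans hxρ
  have hs := summable_localTerm r hp hx hz (hxρ.trans hρ) (hzρ.trans hρ)
  rw [← hs.sum_add_tsum_nat_add 2]
  have e0 : ∑ e ∈ Finset.range 2, localTerm r p x z e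
      = 1 + ((r + 1 : ℕ) : ℝ) * x + ((r * (r + 1) : ℕ) : ℝ) * z := by
    simp only [Finset.sum_range_succ, Finset.sum_range_zero, localTerm, zero_add, pow_zero, pow_one,
      divisorFn_one_right, divisorFn_prime _ hp]
    norm_num
    ring
  rw [e0, add_sub_cancel_left, abs_of_nonneg (tsum_nonneg fun _ => localTerm_nonneg r p hx hz _),
    ← tsum_mul_right]
  refine ((summable_nat_add_iff 2).2 hs).tsum_le_tsum (fun e => ?_)
    ((by simpa using summable_add_pow_mul_half_pow (2 * (r + 1)) 3 : Summable fun e : ℕ =>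
      ((e : ℝ) + 3) ^ (2 * (r + 1)) * (1 / 2 : ℝ) ^ e).mul_right _)
  refine (localTerm_le r hp hx hz hxρ hzρ (e + 2)).trans ?_
  rw [pow_add ρ, ← mul_assoc]
  push_cast
  rw [show (e : ℝ) + 2 + 1 = e + 3 by ring]
  gcongr

theorem abs_one_sub_pow_sub_le {x : ℝ} (h0 : 0 ≤ x) (h1 : x ≤ 1) (a : ℕ) :
    |(1 - x) ^ a - (1 - a * x)| ≤ (a : ℝ) ^ 2 * x ^ 2 := by
  induction a with
  | zero => simp
  | succ a ih =>
    have e : (1 - x) ^ (a + 1) - (1 - ((a + 1 : ℕ) : ℝ) * x)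
        = (1 - x) * ((1 - x) ^ a - (1 - a * x)) + a * x ^ 2 := by push_cast; ring
    rw [e]
    refine (abs_add_le _ _).trans ?_
    rw [abs_mul, abs_of_nonneg (by linarith : 0 ≤ 1 - x), abs_of_nonneg (by positivity : 0 ≤ a * x ^ 2)]
    have : (1 - x) * |(1 - x) ^ a - (1 - a * x)| ≤ 1 * ((a : ℝ) ^ 2 * x ^ 2) :=
      mul_le_mul (by linarith) ih (abs_nonneg _) zero_le_one
    push_cast
    nlinarith [sq_nonneg x, mul_nonneg (Nat.cast_nonneg (α := ℝ) a) (sq_nonneg x)]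

theorem abs_one_sub_pow_mul_sub_le {x z ρ : ℝ} (hx : 0 ≤ x) (hz : 0 ≤ z) (hxρ : x ≤ ρ) (hzρ : z ≤ ρ)
    (hρ : ρ ≤ 1) (a b : ℕ) :
    |(1 - x) ^ a * (1 - z) ^ b - (1 - a * x - b * z)|
      ≤ ((b : ℝ) ^ 2 + (1 + b) * (a : ℝ) ^ 2 + a * b) * ρ ^ 2 := by
  have h1 := abs_one_sub_pow_sub_le hx (hxρ.trans hρ) a
  have h2 := abs_one_sub_pow_sub_le hz (hzρ.trans hρ) b
  have h3 : 0 ≤ (1 - x) ^ a := pow_nonneg (by linarith) _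
  have h4 : (1 - x) ^ a ≤ 1 := pow_le_one₀ (by linarith) (by linarith)
  have hx2 : x ^ 2 ≤ ρ ^ 2 := by gcongr
  have hz2 : z ^ 2 ≤ ρ ^ 2 := by gcongr
  have hxz : x * z ≤ ρ ^ 2 := by nlinarith
  have h5 : |1 - (b : ℝ) * z| ≤ 1 + b := by
    refine (abs_sub _ _).trans ?_
    rw [abs_one, abs_of_nonneg (by positivity)]
    nlinarith [mul_le_mul_of_nonneg_left (hzρ.trans hρ) (Nat.cast_nonneg (α := ℝ) b)]
  have e : (1 - x) ^ a * (1 - z) ^ b - (1 - a * x - b * z)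
      = (1 - x) ^ a * ((1 - z) ^ b - (1 - b * z)) + ((1 - x) ^ a - (1 - a * x)) * (1 - b * z)
        + a * b * (x * z) := by ring
  rw [e]
  refine (abs_add_three _ _ _).trans ?_
  rw [abs_mul, abs_mul, abs_of_nonneg h3, abs_of_nonneg (by positivity : 0 ≤ (a : ℝ) * b * (x * z))]
  calc _ ≤ 1 * ((b : ℝ) ^ 2 * ρ ^ 2) + ((a : ℝ) ^ 2 * ρ ^ 2) * (1 + b) + a * b * ρ ^ 2 := by
        have h1' := h1.trans (mul_le_mul_of_nonneg_left hx2 (sq_nonneg (a : ℝ)))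
        have h2' := h2.trans (mul_le_mul_of_nonneg_left hz2 (sq_nonneg (b : ℝ)))
        gcongr
    _ = _ := by ring

/-- The normalized local factors are `1 + O(p^{-2})` uniformly. -/
theorem abs_localFactor_sub_one_le (r : ℕ) : ∃ C : ℝ, 0 ≤ C ∧ ∀ p : ℕ, p.Prime → ∀ x z ρ : ℝ,
    0 ≤ x → 0 ≤ z → x ≤ ρ → z ≤ ρ → ρ ≤ 1 / 2 → |localFactor r p x z - 1| ≤ C * ρ ^ 2 := by
  obtain ⟨C, hC, h⟩ := abs_tsum_localTerm_sub_le r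
  set a : ℕ := r + 1
  set b : ℕ := r * (r + 1)
  set D : ℝ := ((b : ℝ) ^ 2 + (1 + b) * (a : ℝ) ^ 2 + a * b)
  have hD : 0 ≤ D := by positivity
  refine ⟨C + (1 + a + b) * D + (a + b) ^ 2, by positivity,
    fun p hp x z ρ hx hz hxρ hzρ hρ => ?_⟩
  have hρ0 : 0 ≤ ρ := hx.trans hxρ
  have h1 := h p hp x z ρ hx hz hxρ hzρ hρ
  have h2 := abs_one_sub_pow_mul_sub_le hx hz hxρ hzρ (by linarith) a b
  unfold localFactor
  set E := ∑' e, localTerm r p x z e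
  change |E * ((1 - x) ^ a * (1 - z) ^ b) - 1| ≤ _
  set B := (1 - x) ^ a * (1 - z) ^ b
  have hB0 : 0 ≤ B := mul_nonneg (pow_nonneg (by linarith) _) (pow_nonneg (by linarith) _)
  have hB1 : B ≤ 1 := mul_le_one₀ (pow_le_one₀ (by linarith) (by linarith))
    (pow_nonneg (by linarith) _) (pow_le_one₀ (by linarith) (by linarith))
  have hax : (a : ℝ) * x ≤ a * ρ := by gcongr
  have hbz : (b : ℝ) * z ≤ b * ρ := by gcongr
  have ha0 : 0 ≤ (a : ℝ) * x := by positivity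
  have hb0 : 0 ≤ (b : ℝ) * z := by positivity
  have ha1 : (a : ℝ) * ρ ≤ a := mul_le_of_le_one_right (by positivity) (by linarith)
  have hb1 : (b : ℝ) * ρ ≤ b := mul_le_of_le_one_right (by positivity) (by linarith)
  -- The linear terms of the two factors cancel: `(1 + l)(1 - l) = 1 - l²` with `l = ax + bz`.
  have e : E * B - 1 = (E - (1 + a * x + b * z)) * B + (1 + a * x + b * z) * (B - (1 - a * x - b * z))
      + -(a * x + b * z) ^ 2 := by ring
  rw [e]
  refine (abs_add_three _ _ _).trans ?_
  rw [abs_mul _ B, abs_of_nonneg hB0,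
    abs_mul (1 + (a : ℝ) * x + b * z), abs_of_nonneg (by positivity : 0 ≤ 1 + (a : ℝ) * x + b * z),
    abs_neg, abs_of_nonneg (sq_nonneg (a * x + b * z : ℝ))]
  have t1 : |E - (1 + a * x + b * z)| * B ≤ C * ρ ^ 2 * 1 := by gcongr
  have t2 : (1 + (a : ℝ) * x + b * z) * |B - (1 - a * x - b * z)| ≤ (1 + a + b) * (D * ρ ^ 2) := by
    gcongr <;> linarith
  have t3 : ((a : ℝ) * x + b * z) ^ 2 ≤ (a * ρ + b * ρ) ^ 2 := by gcongr
  calc _ ≤ C * ρ ^ 2 * 1 + (1 + a + b) * (D * ρ ^ 2) + (a * ρ + b * ρ) ^ 2 := by linarith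
    _ = _ := by ring

/-- At `x = z = 1/p` the inner sum collapses to `d_{r+1}(p^e)/p^e` and the exponents add up to
`(r+1)²`. This identifies the limiting Euler product with `a_{r+1}`. -/
theorem localFactor_diagonal (r : ℕ) {p : ℕ} (hp : p.Prime) :
    localFactor r p (1 / p) (1 / p) = (1 - 1 / (p : ℝ)) ^ ((r + 1) ^ 2) *
      ∑' n : ℕ, (divisorFn (r + 1) (p ^ n) : ℝ) ^ 2 / (p : ℝ) ^ n := by
  unfold localFactor
  rw [← pow_add, show r + 1 + r * (r + 1) = (r + 1) ^ 2 by ring, mul_comm]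
  congr 1
  refine tsum_congr fun e => ?_
  have hp0 : (p : ℝ) ≠ 0 := by exact_mod_cast hp.ne_zero
  have : ∑ j ∈ Finset.range (e + 1), (1 / (p : ℝ)) ^ (e - j) * (divisorFn r (p ^ j) * (1 / (p : ℝ)) ^ j)
      = divisorFn (r + 1) (p ^ e) / (p : ℝ) ^ e := by
    rw [divisorFn_succ, Nat.sum_divisors_prime_pow hp, Nat.cast_sum, Finset.sum_div]
    refine Finset.sum_congr rfl fun j hj => ?_
    have hj : j ≤ e := by simpa [Nat.lt_succ_iff] using hj
    rw [mul_left_comm, ← pow_add, Nat.sub_add_cancel hj, one_div, inv_pow, div_eq_mul_inv]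
  rw [localTerm, this]
  ring

theorem tendsto_localFactor (r : ℕ) {p : ℕ} (hp : p.Prime) {ι : Type*} {l : Filter ι} {x z : ι → ℝ}
    {x₀ z₀ : ℝ} (hx : Tendsto x l (𝓝 x₀)) (hz : Tendsto z l (𝓝 z₀))
    (hx0 : ∀ᶠ i in l, 0 ≤ x i ∧ x i ≤ 1 / 2) (hz0 : ∀ᶠ i in l, 0 ≤ z i ∧ z i ≤ 1 / 2) :
    Tendsto (fun i => localFactor r p (x i) (z i)) l (𝓝 (localFactor r p x₀ z₀)) := by
  unfold localFactor
  refine Tendsto.mul ?_ (((hx.const_sub 1).pow _).mul ((hz.const_sub 1).pow _))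
  refine tendsto_tsum_of_dominated_convergence
    (bound := fun e : ℕ => ((e : ℝ) + (1 : ℕ)) ^ (2 * (r + 1)) * (1 / 2 : ℝ) ^ e)
    (summable_add_pow_mul_half_pow (2 * (r + 1)) 1) (fun e => ?_) ?_
  · unfold localTerm
    refine Tendsto.const_mul _ (tendsto_finsetSum _ fun j _ => ?_)
    exact (hx.pow _).mul ((hz.pow _).const_mul _)
  · filter_upwards [hx0, hz0] with i h1 h2 e
    rw [Real.norm_of_nonneg (localTerm_nonneg r p h1.1 h2.1 e)]
    simpa using localTerm_le r hp h1.1 h2.1 h1.2 h2.2 e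

/-! ### Euler product of the double Dirichlet series -/

/-- The arithmetic function `n ↦ n^{-1-s}`. -/
noncomputable def rpowArith (s : ℝ) : ArithmeticFunction ℝ :=
  ⟨fun n => if n = 0 then 0 else (n : ℝ) ^ (-1 - s), by simp⟩

theorem rpowArith_apply {n : ℕ} (hn : n ≠ 0) (s : ℝ) : rpowArith s n = (n : ℝ) ^ (-1 - s) := by
  simp [rpowArith, hn]

theorem rpowArith_nonneg (s : ℝ) (n : ℕ) : 0 ≤ rpowArith s n := by
  rcases eq_or_ne n 0 with rfl | h
  · simp
  · rw [rpowArith_apply h]; positivity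

theorem rpowArith_prime_pow {p : ℕ} (hp : p.Prime) (s : ℝ) (e : ℕ) :
    rpowArith s (p ^ e) = ((p : ℝ) ^ (-1 - s)) ^ e := by
  rw [rpowArith_apply (pow_ne_zero _ hp.ne_zero), Nat.cast_pow, ← Real.rpow_natCast,
    ← Real.rpow_natCast, ← Real.rpow_mul (by positivity), ← Real.rpow_mul (by positivity), mul_comm]

theorem rpowArith_isMultiplicative (s : ℝ) : (rpowArith s).IsMultiplicative := by
  rw [ArithmeticFunction.IsMultiplicative.iff_ne_zero]
  refine ⟨by simp [rpowArith], fun {m n} hm hn _ => ?_⟩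
  rw [rpowArith_apply (mul_ne_zero hm hn), rpowArith_apply hm, rpowArith_apply hn, Nat.cast_mul,
    Real.mul_rpow (by positivity) (by positivity)]

theorem summable_rpowArith {s : ℝ} (hs : 0 < s) : Summable (fun n => rpowArith s n) := by
  refine Summable.of_nonneg_of_le (rpowArith_nonneg s) (fun n => ?_)
    (Real.summable_nat_rpow.2 (by linarith : -1 - s < -1))
  rcases eq_or_ne n 0 with rfl | h
  · simp; positivity
  · rw [rpowArith_apply h]

/-- The arithmetic function `n ↦ ∑_{kj = n} d_{r+1}(n) d_r(j) k^{-1-s} j^{-1-w}`. -/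
noncomputable def crossArith (r : ℕ) (s w : ℝ) : ArithmeticFunction ℝ :=
  ((ArithmeticFunction.zeta ^ (r + 1) : ArithmeticFunction ℕ) : ArithmeticFunction ℝ).pmul
    (rpowArith s * ((ArithmeticFunction.zeta ^ r : ArithmeticFunction ℕ) :
      ArithmeticFunction ℝ).pmul (rpowArith w))

theorem crossArith_apply (r : ℕ) (s w : ℝ) (n : ℕ) :
    crossArith r s w n = divisorFn (r + 1) n *
      ∑ x ∈ n.divisorsAntidiagonal, rpowArith s x.1 * (divisorFn r x.2 * rpowArith w x.2) := by
  simp [crossArith, divisorFn, ArithmeticFunction.mul_apply]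

theorem crossArith_isMultiplicative (r : ℕ) (s w : ℝ) : (crossArith r s w).IsMultiplicative :=
  (divisorFn_isMultiplicative _).natCast.pmul ((rpowArith_isMultiplicative s).mul
    ((divisorFn_isMultiplicative _).natCast.pmul (rpowArith_isMultiplicative w)))

theorem crossArith_nonneg (r : ℕ) (s w : ℝ) (n : ℕ) : 0 ≤ crossArith r s w n := by
  rw [crossArith_apply]
  exact mul_nonneg (Nat.cast_nonneg _) (Finset.sum_nonneg fun x _ => mul_nonneg
    (rpowArith_nonneg _ _) (mul_nonneg (Nat.cast_nonneg _) (rpowArith_nonneg _ _)))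

theorem crossArith_prime_pow (r : ℕ) (s w : ℝ) {p : ℕ} (hp : p.Prime) (e : ℕ) :
    crossArith r s w (p ^ e) = localTerm r p ((p : ℝ) ^ (-1 - s)) ((p : ℝ) ^ (-1 - w)) e := by
  rw [crossArith_apply, localTerm, Nat.sum_divisorsAntidiagonal'
    (f := fun x y => rpowArith s x * (divisorFn r y * rpowArith w y)), Nat.sum_divisors_prime_pow hp]
  congr 1
  refine Finset.sum_congr rfl fun j hj => ?_
  have hj : j ≤ e := by simpa [Nat.lt_succ_iff] using hj
  rw [Nat.pow_div hj hp.pos, rpowArith_prime_pow hp, rpowArith_prime_pow hp]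

/-- The terms of the double Dirichlet series `∑ d_{r+1}(kn) d_r(n) k^{-1-s} n^{-1-w}`. -/
noncomputable def pairTerm (r : ℕ) (s w : ℝ) (x : ℕ+ × ℕ+) : ℝ :=
  divisorFn (r + 1) (x.1 * x.2) * divisorFn r x.2 * ((x.1 : ℕ) : ℝ) ^ (-1 - s) * ((x.2 : ℕ) : ℝ) ^ (-1 - w)

theorem pairTerm_nonneg (r : ℕ) (s w : ℝ) (x : ℕ+ × ℕ+) : 0 ≤ pairTerm r s w x := by
  unfold pairTerm; positivity

/-- The coefficient is at most `d_{r+1}(k) d_{(r+1)r}(n)`, which separates the variables. -/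
theorem summable_pairTerm (r : ℕ) {s w : ℝ} (hs : 0 < s) (hw : 0 < w) :
    Summable (pairTerm r s w) := by
  have h1 : Summable fun n : ℕ+ => (divisorFn (r + 1) n : ℝ) * ((n : ℕ) : ℝ) ^ (-1 - s) :=
    (summable_divisorFn_mul_rpow (r + 1) hs).comp_injective PNat.coe_injective
  have h2 : Summable fun n : ℕ+ => (divisorFn ((r + 1) * r) n : ℝ) * ((n : ℕ) : ℝ) ^ (-1 - w) :=
    (summable_divisorFn_mul_rpow ((r + 1) * r) hw).comp_injective PNat.coe_injective
  refine Summable.of_nonneg_of_le (pairTerm_nonneg r s w) (fun x => ?_)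
    (h1.mul_of_nonneg h2 (fun _ => by positivity) fun _ => by positivity)
  have h : (divisorFn (r + 1) (x.1 * x.2) * divisorFn r x.2 : ℝ)
      ≤ divisorFn (r + 1) x.1 * divisorFn ((r + 1) * r) x.2 := by
    have := (Nat.mul_le_mul_right (divisorFn r x.2) (divisorFn_mul_le (r + 1) x.1 x.2)).trans
      ((mul_assoc _ _ _).trans_le (Nat.mul_le_mul_left (divisorFn (r + 1) x.1)
        (divisorFn_mul_divisorFn_le (r + 1) r x.2)))
    exact_mod_cast this
  calc pairTerm r s w x ≤ (divisorFn (r + 1) x.1 * divisorFn ((r + 1) * r) x.2)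
        * ((x.1 : ℕ) : ℝ) ^ (-1 - s) * ((x.2 : ℕ) : ℝ) ^ (-1 - w) := by
        unfold pairTerm; gcongr
    _ = _ := by ring

/-- Grouping the pairs `(k, n)` by their product turns the double series into a sum of one
multiplicative function, to which the Euler product applies. -/
theorem hasSum_crossArith (r : ℕ) {s w : ℝ} (hs : 0 < s) (hw : 0 < w) :
    HasSum (fun n => crossArith r s w n) (∑' x, pairTerm r s w x) := by
  have h1 := (summable_pairTerm r hs hw).hasSum
  rw [← sigmaAntidiagonalEquivProd.hasSum_iff] at h1
  have h2 := h1.sigma (g := fun n : ℕ+ => crossArith r s w n) fun n => by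
    have h3 : crossArith r s w n = ∑ x : (n : ℕ).divisorsAntidiagonal,
        divisorFn (r + 1) n * (rpowArith s x.1.1 * (divisorFn r x.1.2 * rpowArith w x.1.2)) := by
      rw [crossArith_apply, Finset.mul_sum]
      exact (Finset.sum_coe_sort (n : ℕ).divisorsAntidiagonal fun x =>
        (divisorFn (r + 1) n : ℝ) * (rpowArith s x.1 * (divisorFn r x.2 * rpowArith w x.2))).symm
    rw [h3]
    convert hasSum_fintype _ using 2 with x
    obtain ⟨⟨a, b⟩, hx⟩ := x
    obtain ⟨hab, hn⟩ := Nat.mem_divisorsAntidiagonal.1 hx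
    have ha : a ≠ 0 := by rintro rfl; simp at hab; exact hn hab.symm
    have hb : b ≠ 0 := by rintro rfl; simp at hab; exact hn hab.symm
    simp only [Function.comp_apply, pairTerm, sigmaAntidiagonalEquivProd,
      divisorsAntidiagonalFactors, Equiv.coe_fn_mk, PNat.mk_coe]
    rw [rpowArith_apply ha, rpowArith_apply hb, ← hab]
    ring
  exact (PNat.coe_injective.hasSum_iff fun n hn => by
    have : n = 0 := by
      by_contra h
      exact hn ⟨⟨n, Nat.pos_of_ne_zero h⟩, rfl⟩
    simp [this]).1 h2

theorem prime_rpow_nonneg_le (p : Nat.Primes) {s : ℝ} (hs : 0 ≤ s) :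
    0 ≤ ((p : ℕ) : ℝ) ^ (-1 - s) ∧ ((p : ℕ) : ℝ) ^ (-1 - s) ≤ 1 / (p : ℕ) ∧ (1 : ℝ) / (p : ℕ) ≤ 1 / 2 := by
  have h2 : (2 : ℝ) ≤ (p : ℕ) := by exact_mod_cast p.2.two_le
  refine ⟨by positivity, ?_, one_div_le_one_div_of_le two_pos h2⟩
  rw [one_div, ← Real.rpow_neg_one]
  exact Real.rpow_le_rpow_of_exponent_le (by linarith) (by linarith)

theorem hasProd_zeta {s : ℝ} (hs : 0 < s) :
    HasProd (fun p : Nat.Primes => (1 - ((p : ℕ) : ℝ) ^ (-1 - s))⁻¹) (∑' n, rpowArith s n) := by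
  have h := (rpowArith_isMultiplicative s).eulerProduct_hasProd
    ((summable_rpowArith hs).congr fun n => (Real.norm_of_nonneg (rpowArith_nonneg s n)).symm)
  have e : (fun p : Nat.Primes => ∑' e, rpowArith s ((p : ℕ) ^ e))
      = fun p : Nat.Primes => (1 - ((p : ℕ) : ℝ) ^ (-1 - s))⁻¹ := by
    funext p
    simp_rw [rpowArith_prime_pow p.2]
    obtain ⟨h0, h1, h2⟩ := prime_rpow_nonneg_le p hs.le
    rw [tsum_geometric_of_lt_one h0 (by linarith)]
  rw [e] at h
  exact h

theorem summable_one_div_primes_sq (C : ℝ) :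
    Summable fun p : Nat.Primes => C * (1 / ((p : ℕ) : ℝ)) ^ 2 := by
  have h : Summable fun n : ℕ => 1 / (n : ℝ) ^ 2 := Real.summable_one_div_nat_pow.2 one_lt_two
  exact ((h.comp_injective Nat.Primes.coe_nat_injective).congr fun p => by
    simp).mul_left C

theorem tsum_pairTerm_eq (r : ℕ) {s w : ℝ} (hs : 0 < s) (hw : 0 < w) :
    ∑' x, pairTerm r s w x = (∑' n, rpowArith s n) ^ (r + 1) * (∑' n, rpowArith w n) ^ (r * (r + 1))
      * ∏' p : Nat.Primes, localFactor r p (((p : ℕ) : ℝ) ^ (-1 - s)) (((p : ℕ) : ℝ) ^ (-1 - w)) := by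
  obtain ⟨C, hC, hbound⟩ := abs_localFactor_sub_one_le r
  have hsum := hasSum_crossArith r hs hw
  have h1 := (crossArith_isMultiplicative r s w).eulerProduct_hasProd
    (hsum.summable.congr fun n => (Real.norm_of_nonneg (crossArith_nonneg r s w n)).symm)
  rw [hsum.tsum_eq] at h1
  have hmult : Multipliable fun p : Nat.Primes =>
      localFactor r p (((p : ℕ) : ℝ) ^ (-1 - s)) (((p : ℕ) : ℝ) ^ (-1 - w)) := by
    have := multipliable_one_add_of_summable (f := fun p : Nat.Primes =>
      localFactor r p (((p : ℕ) : ℝ) ^ (-1 - s)) (((p : ℕ) : ℝ) ^ (-1 - w)) - 1) ?_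
    · simpa using this
    · refine Summable.of_nonneg_of_le (fun _ => norm_nonneg _) (fun p => ?_)
        (summable_one_div_primes_sq C)
      obtain ⟨a1, a2, a3⟩ := prime_rpow_nonneg_le p hs.le
      obtain ⟨b1, b2, _⟩ := prime_rpow_nonneg_le p hw.le
      exact hbound p p.2 _ _ _ a1 b1 a2 b2 a3
  have h2 := (((hasProd_zeta hs).pow (r + 1)).mul ((hasProd_zeta hw).pow (r * (r + 1)))).mul
    hmult.hasProd
  have e : (fun p : Nat.Primes => ∑' e, crossArith r s w ((p : ℕ) ^ e))
      = fun p : Nat.Primes => (1 - ((p : ℕ) : ℝ) ^ (-1 - s))⁻¹ ^ (r + 1)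
        * (1 - ((p : ℕ) : ℝ) ^ (-1 - w))⁻¹ ^ (r * (r + 1))
        * localFactor r p (((p : ℕ) : ℝ) ^ (-1 - s)) (((p : ℕ) : ℝ) ^ (-1 - w)) := by
    funext p
    simp_rw [crossArith_prime_pow r s w p.2]
    obtain ⟨a1, a2, a3⟩ := prime_rpow_nonneg_le p hs.le
    obtain ⟨b1, b2, _⟩ := prime_rpow_nonneg_le p hw.le
    have ha : (1 - ((p : ℕ) : ℝ) ^ (-1 - s)) ≠ 0 := by linarith
    have hb : (1 - ((p : ℕ) : ℝ) ^ (-1 - w)) ≠ 0 := by linarith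
    have ha' := pow_ne_zero (r + 1) ha
    have hb' := pow_ne_zero (r * (r + 1)) hb
    rw [localFactor, inv_pow, inv_pow]
    field_simp
  rw [e] at h1
  exact HasProd.unique h1 h2

/-! ### Behaviour of the double series at the origin -/

theorem tendsto_mul_zeta {α : ℝ} (hα : 0 < α) :
    Tendsto (fun σ : ℝ => σ * ∑' n, rpowArith (α * σ) n) (𝓝[>] 0) (𝓝 α⁻¹) := by
  have hlim : Tendsto (fun σ : ℝ => 1 + α * σ) (𝓝[>] 0) (𝓝[>] 1) := by
    refine tendsto_nhdsWithin_iff.2 ⟨?_, ?_⟩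
    · have : Tendsto (fun σ : ℝ => 1 + α * σ) (𝓝 0) (𝓝 (1 + α * 0)) := by
        exact (continuous_const.add (continuous_const.mul continuous_id)).tendsto _
      simpa using this.mono_left nhdsWithin_le_nhds
    · filter_upwards [self_mem_nhdsWithin] with σ hσ
      have : 0 < α * σ := mul_pos hα hσ
      simpa using this
  have h := (tendsto_sub_mul_tsum_nat_rpow.comp hlim).const_mul α⁻¹
  rw [mul_one] at h
  refine h.congr' ?_
  filter_upwards [self_mem_nhdsWithin] with σ hσ
  have hσ : 0 < α * σ := mul_pos hα hσ
  simp only [Function.comp_apply, add_sub_cancel_left]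
  rw [← mul_assoc, ← mul_assoc, inv_mul_cancel₀ hα.ne', one_mul]
  congr 1
  refine tsum_congr fun n => ?_
  rcases eq_or_ne n 0 with rfl | hn
  · rw [Nat.cast_zero, Real.zero_rpow (by linarith)]; simp
  · rw [rpowArith_apply hn, one_div, ← Real.rpow_neg (by positivity)]
    congr 1
    ring

/-- Dominated convergence for infinite products: the bound `C p^{-2}` on the deviation of each
factor from `1` is uniform in `σ`. -/
theorem tendsto_tprod_localFactor (r : ℕ) {α β : ℝ} (hα : 0 < α) (hβ : 0 < β) :
    Tendsto (fun σ : ℝ => ∏' p : Nat.Primes,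
      localFactor r p (((p : ℕ) : ℝ) ^ (-1 - α * σ)) (((p : ℕ) : ℝ) ^ (-1 - β * σ)))
      (𝓝[>] 0) (𝓝 (arithConst (r + 1))) := by
  obtain ⟨C, hC, hbound⟩ := abs_localFactor_sub_one_le r
  have hconst : arithConst (r + 1)
      = ∏' p : Nat.Primes, (1 + (localFactor r p (1 / (p : ℕ)) (1 / (p : ℕ)) - 1)) := by
    rw [arithConst]
    exact tprod_congr fun p => by rw [add_sub_cancel, localFactor_diagonal r p.2]
  rw [hconst]
  have hlim : ∀ γ : ℝ, ∀ p : Nat.Primes,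
      Tendsto (fun σ : ℝ => ((p : ℕ) : ℝ) ^ (-1 - γ * σ)) (𝓝[>] 0) (𝓝 (1 / (p : ℕ))) := by
    intro γ p
    have hp : (0 : ℝ) < (p : ℕ) := by exact_mod_cast p.2.pos
    have : Continuous fun σ : ℝ => ((p : ℕ) : ℝ) ^ (-1 - γ * σ) :=
      continuous_const.rpow (by fun_prop) fun _ => Or.inl hp.ne'
    have := (this.tendsto 0).mono_left (nhdsWithin_le_nhds (s := Set.Ioi 0))
    simpa [Real.rpow_neg_one] using this
  have hev : ∀ γ : ℝ, 0 < γ → ∀ p : Nat.Primes, ∀ᶠ σ : ℝ in 𝓝[>] 0,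
      0 ≤ ((p : ℕ) : ℝ) ^ (-1 - γ * σ) ∧ ((p : ℕ) : ℝ) ^ (-1 - γ * σ) ≤ 1 / 2 := by
    intro γ hγ p
    filter_upwards [self_mem_nhdsWithin] with σ hσ
    obtain ⟨a1, a2, a3⟩ := prime_rpow_nonneg_le p (mul_pos hγ hσ).le
    exact ⟨a1, a2.trans a3⟩
  have h := tendsto_tprod_one_add_of_dominated_convergence (𝓕 := 𝓝[>] (0 : ℝ))
    (f := fun (σ : ℝ) (p : Nat.Primes) =>
      localFactor r p (((p : ℕ) : ℝ) ^ (-1 - α * σ)) (((p : ℕ) : ℝ) ^ (-1 - β * σ)) - 1)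
    (summable_one_div_primes_sq C)
    (fun p => (tendsto_localFactor r p.2 (hlim α p) (hlim β p) (hev α hα p) (hev β hβ p)).sub_const 1)
    (by
      filter_upwards [self_mem_nhdsWithin] with σ hσ p
      obtain ⟨a1, a2, a3⟩ := prime_rpow_nonneg_le p (mul_pos hα hσ).le
      obtain ⟨b1, b2, _⟩ := prime_rpow_nonneg_le p (mul_pos hβ hσ).le
      exact hbound p p.2 _ _ _ a1 b1 a2 b2 a3)
  simpa using h

/-- An absolutely convergent product of positive factors does not vanish. This makes the main term
genuinely of size `T (log y)^{(r+1)²}` in the asymptotic equivalence. -/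
theorem arithConst_ne_zero (r : ℕ) : arithConst (r + 1) ≠ 0 := by
  obtain ⟨C, hC, hbound⟩ := abs_localFactor_sub_one_le r
  have hconst : arithConst (r + 1)
      = ∏' p : Nat.Primes, (1 + (localFactor r p (1 / (p : ℕ)) (1 / (p : ℕ)) - 1)) := by
    rw [arithConst]
    exact tprod_congr fun p => by rw [add_sub_cancel, localFactor_diagonal r p.2]
  have h0 : ∀ p : Nat.Primes, (0 : ℝ) ≤ 1 / (p : ℕ) ∧ (1 : ℝ) / (p : ℕ) ≤ 1 / 2 := fun p =>
    ⟨by positivity, (prime_rpow_nonneg_le p le_rfl).2.2⟩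
  rw [hconst]
  refine tprod_one_add_ne_zero_of_summable (fun p => ?_)
    (Summable.of_nonneg_of_le (fun _ => norm_nonneg _) (fun p =>
      hbound p p.2 _ _ _ (h0 p).1 (h0 p).1 le_rfl le_rfl (h0 p).2) (summable_one_div_primes_sq C))
  rw [add_sub_cancel, localFactor]
  have hs := summable_localTerm r p.2 (h0 p).1 (h0 p).1 (h0 p).2 (h0 p).2
  have h1 : 0 < 1 - (1 : ℝ) / (p : ℕ) := by linarith [(h0 p).2]
  have h2 : 0 < ∑' e, localTerm r p (1 / (p : ℕ)) (1 / (p : ℕ)) e :=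
    hs.tsum_pos (localTerm_nonneg r p (h0 p).1 (h0 p).1) 0
      (by simp [localTerm, divisorFn_one_right])
  positivity

/-- The zeta powers have poles of total order `r+1 + r(r+1) = (r+1)²`. Allowing arbitrary `α` and
`β` is what later yields every mixed moment. -/
theorem tendsto_tsum_pairTerm (r : ℕ) {α β : ℝ} (hα : 0 < α) (hβ : 0 < β) :
    Tendsto (fun σ : ℝ => σ ^ ((r + 1) ^ 2) * ∑' x, pairTerm r (α * σ) (β * σ) x) (𝓝[>] 0)
      (𝓝 (arithConst (r + 1) * (α⁻¹ ^ (r + 1) * β⁻¹ ^ (r * (r + 1))))) := by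
  have h := (tendsto_tprod_localFactor r hα hβ).mul
    (((tendsto_mul_zeta hα).pow (r + 1)).mul ((tendsto_mul_zeta hβ).pow (r * (r + 1))))
  refine h.congr' ?_
  filter_upwards [self_mem_nhdsWithin] with σ hσ
  rw [tsum_pairTerm_eq r (mul_pos hα hσ) (mul_pos hβ hσ),
    show (r + 1) ^ 2 = (r + 1) + r * (r + 1) by ring, pow_add]
  ring

/-! ### The method of moments on the unit square -/

open MeasureTheory ProbabilityTheory

section Moments

variable {τ ι : Type*} {l : Filter τ} {w : τ → ι → ℝ}

theorem abs_tsum_mul_le {v f g : ι → ℝ} (hv : ∀ i, 0 ≤ v i) (hs : Summable v)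
    {M : ℝ} (hg : ∀ i, |g i| ≤ M) (hfg : ∀ i, |f i| ≤ g i) :
    Summable (fun i => v i * f i) ∧ |∑' i, v i * f i| ≤ ∑' i, v i * g i := by
  have h1 : Summable fun i => v i * g i := by
    refine Summable.of_norm_bounded (hs.mul_right M) fun i => ?_
    rw [norm_mul, Real.norm_of_nonneg (hv i)]
    exact mul_le_mul_of_nonneg_left (hg i) (hv i)
  have h2 : ∀ i, ‖v i * f i‖ ≤ v i * g i := fun i => by
    rw [norm_mul, Real.norm_of_nonneg (hv i)]
    exact mul_le_mul_of_nonneg_left (hfg i) (hv i)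
  exact ⟨Summable.of_norm_bounded h1 h2, tsum_of_norm_bounded h1.hasSum h2⟩

theorem summable_mul_of_abs_le {v f : ι → ℝ} (hv : ∀ i, 0 ≤ v i) (hs : Summable v)
    {M : ℝ} (hf : ∀ i, |f i| ≤ M) : Summable fun i => v i * f i :=
  (abs_tsum_mul_le hv hs (g := fun _ => M)
    (fun i => by rw [abs_of_nonneg ((abs_nonneg _).trans (hf i))]) hf).1

theorem ContinuousMap.exists_abs_le {X : Type*} [TopologicalSpace X] [CompactSpace X] (φ : C(X, ℝ)) :
    ∃ M : ℝ, 0 ≤ M ∧ ∀ x, |φ x| ≤ M :=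
  ⟨‖φ‖, norm_nonneg _, fun x => φ.norm_coe_le_norm x⟩

variable {z : τ → ι → unitInterval × unitInterval} {ν : Measure (unitInterval × unitInterval)}
  [IsFiniteMeasure ν] {κ : ℝ}

/-- Convergence of all mixed moments of discrete measures on the unit square implies convergence
of the integrals of all continuous functions. -/
theorem tendsto_tsum_continuous_of_moments (hw : ∀ᶠ t in l, (∀ i, 0 ≤ w t i) ∧ Summable (w t))
    (hm : ∀ a b : ℕ, Tendsto (fun t => ∑' i, w t i * (((z t i).1 : ℝ) ^ a * ((z t i).2 : ℝ) ^ b)) l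
      (𝓝 (κ * ∫ x, (x.1 : ℝ) ^ a * (x.2 : ℝ) ^ b ∂ν)))
    (φ : C(unitInterval × unitInterval, ℝ)) :
    Tendsto (fun t => ∑' i, w t i * φ (z t i)) l (𝓝 (κ * ∫ x, φ x ∂ν)) := by
  set X : C(unitInterval × unitInterval, ℝ) := ⟨fun x => (x.1 : ℝ), by fun_prop⟩ with hX
  set Y : C(unitInterval × unitInterval, ℝ) := ⟨fun x => (x.2 : ℝ), by fun_prop⟩ with hY
  have hint : ∀ ψ : C(unitInterval × unitInterval, ℝ), Integrable (fun x => ψ x) ν := fun ψ =>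
    (BoundedContinuousFunction.mkOfCompact ψ).integrable ν
  -- The algebra generated by the coordinates is spanned by the monomials `X^a Y^b`, so linearity
  -- suffices; it is dense by Stone–Weierstrass.
  have hadj : ∀ ψ ∈ Algebra.adjoin ℝ {X, Y},
      Tendsto (fun t => ∑' i, w t i * ψ (z t i)) l (𝓝 (κ * ∫ x, ψ x ∂ν)) := by
    intro ψ hψ
    rw [← Subalgebra.mem_toSubmodule, Algebra.adjoin_eq_span] at hψ
    induction hψ using Submodule.span_induction with
    | mem ψ h =>
      obtain ⟨a, b, rfl⟩ := (Submonoid.mem_closure_pair _ _ _).1 h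
      simpa [hX, hY] using hm a b
    | zero => simpa using tendsto_const_nhds
    | add f g _ _ hf hg =>
      have e : κ * ∫ x, (f + g) x ∂ν = κ * ∫ x, f x ∂ν + κ * ∫ x, g x ∂ν := by
        rw [← mul_add, ← integral_add (hint f) (hint g)]; rfl
      rw [e]
      refine (hf.add hg).congr' ?_
      filter_upwards [hw] with t ht
      obtain ⟨Mf, _, hMf⟩ := f.exists_abs_le
      obtain ⟨Mg, _, hMg⟩ := g.exists_abs_le
      rw [← (summable_mul_of_abs_le ht.1 ht.2 fun i => hMf (z t i)).tsum_add
        (summable_mul_of_abs_le ht.1 ht.2 fun i => hMg (z t i))]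
      exact tsum_congr fun i => by simp [mul_add]
    | smul c f _ hf =>
      have e : κ * ∫ x, (c • f) x ∂ν = c * (κ * ∫ x, f x ∂ν) := by
        simp only [ContinuousMap.coe_smul, Pi.smul_apply, smul_eq_mul, integral_const_mul]
        ring
      rw [e]
      refine (hf.const_mul c).congr fun t => ?_
      rw [← tsum_mul_left]
      exact tsum_congr fun i => by simp only [ContinuousMap.coe_smul, Pi.smul_apply, smul_eq_mul]; ring
  have hsep : (Algebra.adjoin ℝ {X, Y}).SeparatesPoints := by
    intro p q hpq
    by_cases h : p.1 = q.1
    · refine ⟨Y, ⟨Y, Algebra.subset_adjoin (by simp), rfl⟩, fun h2 => hpq (Prod.ext h ?_)⟩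
      exact Subtype.ext h2
    · exact ⟨X, ⟨X, Algebra.subset_adjoin (by simp), rfl⟩, fun h2 => h (Subtype.ext h2)⟩
  -- The `(0,0)` moment bounds the total masses, so a uniformly small error in the test function
  -- stays small after summation.
  have hone : Tendsto (fun t => ∑' i, w t i) l (𝓝 (κ * ν.real Set.univ)) := by
    simpa using hm 0 0
  set C : ℝ := κ * ν.real Set.univ + 1
  rw [Metric.tendsto_nhds]
  intro ε hε
  set D : ℝ := 1 + |C| + |κ| * ν.real Set.univ
  have hD : 0 < D := by positivity
  obtain ⟨⟨ψ, hψ⟩, hφψ⟩ := ContinuousMap.exists_mem_subalgebra_near_continuousMap_of_separatesPoints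
    _ hsep φ (ε / (2 * D)) (by positivity)
  have hψn : ∀ x, |φ x - ψ x| ≤ ε / (2 * D) := fun x => by
    rw [abs_sub_comm]
    exact ((ψ - φ).norm_coe_le_norm x).trans hφψ.le
  have hν : |κ * ∫ x, φ x ∂ν - κ * ∫ x, ψ x ∂ν| ≤ ε / (2 * D) * (|κ| * ν.real Set.univ) := by
    rw [← mul_sub, ← integral_sub (hint φ) (hint ψ), abs_mul]
    have := norm_integral_le_of_norm_le_const (μ := ν) (f := fun x => φ x - ψ x)
      (ae_of_all _ hψn)
    rw [Real.norm_eq_abs] at this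
    calc _ ≤ |κ| * (ε / (2 * D) * ν.real Set.univ) := by gcongr
      _ = _ := by ring
  filter_upwards [hw, hone.eventually_lt_const (lt_add_one _),
    (Metric.tendsto_nhds.1 (hadj ψ hψ)) (ε / 2) (by positivity)] with t ht ht1 ht2
  obtain ⟨Mf, _, hMf⟩ := φ.exists_abs_le
  obtain ⟨Mg, _, hMg⟩ := ψ.exists_abs_le
  have h1 : |∑' i, w t i * φ (z t i) - ∑' i, w t i * ψ (z t i)| ≤ ε / (2 * D) * |C| := by
    rw [← (summable_mul_of_abs_le ht.1 ht.2 fun i => hMf (z t i)).tsum_sub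
        (summable_mul_of_abs_le ht.1 ht.2 fun i => hMg (z t i))]
    have h2 := (abs_tsum_mul_le ht.1 ht.2 (f := fun i => φ (z t i) - ψ (z t i))
      (g := fun _ => ε / (2 * D)) (fun i => (abs_of_pos (by positivity)).le)
      (fun i => hψn (z t i))).2
    simp only [mul_sub] at h2
    refine h2.trans ?_
    rw [tsum_mul_right, mul_comm]
    have : ∑' i, w t i ≤ |C| := ht1.le.trans (le_abs_self _)
    gcongr
  rw [Real.dist_eq] at ht2 ⊢
  have e : ∑' i, w t i * φ (z t i) - κ * ∫ x, φ x ∂ν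
      = (∑' i, w t i * φ (z t i) - ∑' i, w t i * ψ (z t i))
        + (∑' i, w t i * ψ (z t i) - κ * ∫ x, ψ x ∂ν)
        + (κ * ∫ x, ψ x ∂ν - κ * ∫ x, φ x ∂ν) := by ring
  rw [e]
  rw [abs_sub_comm] at hν
  calc _ ≤ _ := abs_add_three _ _ _
    _ < ε / (2 * D) * |C| + ε / 2 + ε / (2 * D) * (|κ| * ν.real Set.univ) := by linarith
    _ ≤ ε / (2 * D) * D + ε / 2 := by
        have : 0 < ε / (2 * D) := by positivity
        simp only [D]
        nlinarith
    _ = ε := by field_simp; norm_num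

/-- The version of the moment method for a continuous function cut off to `{h ≥ 0}`, when the
boundary `{h = 0}` is null for the limit measure. -/
theorem tendsto_tsum_indicator_of_moments (hw : ∀ᶠ t in l, (∀ i, 0 ≤ w t i) ∧ Summable (w t))
    (hm : ∀ a b : ℕ, Tendsto (fun t => ∑' i, w t i * (((z t i).1 : ℝ) ^ a * ((z t i).2 : ℝ) ^ b)) l
      (𝓝 (κ * ∫ x, (x.1 : ℝ) ^ a * (x.2 : ℝ) ^ b ∂ν)))
    (φ h : C(unitInterval × unitInterval, ℝ)) (h0 : ν {x | h x = 0} = 0) :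
    Tendsto (fun t => ∑' i, w t i * {x | 0 ≤ h x}.indicator φ (z t i)) l
      (𝓝 (κ * ∫ x, {x | 0 ≤ h x}.indicator φ x ∂ν)) := by
  have hcont := fun ψ => tendsto_tsum_continuous_of_moments (z := z) (ν := ν) (κ := κ) hw hm ψ
  have hint : ∀ ψ : C(unitInterval × unitInterval, ℝ), Integrable (fun x => ψ x) ν := fun ψ =>
    (BoundedContinuousFunction.mkOfCompact ψ).integrable ν
  obtain ⟨M, hM0, hM⟩ := φ.exists_abs_le
  -- For `n ≥ 1`, `χ n` is a ramp rising from `0` at `h = 0` to `1` at `h = 1/n`. The bump `d n` is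
  -- supported in `|h| ≤ 1/n` and dominates the error of replacing the cutoff by the ramp; its
  -- integral tends to `0` because `{h = 0}` is null.
  set χ : ℕ → C(unitInterval × unitInterval, ℝ) := fun n => ⟨fun x => max 0 (min 1 (n * h x)), by fun_prop⟩ with hχ
  set d : ℕ → C(unitInterval × unitInterval, ℝ) := fun n =>
    ⟨fun x => max 0 (min 1 (1 + n * h x)) - max 0 (min 1 (n * h x)), by fun_prop⟩ with hd
  have hd0 : ∀ n x, 0 ≤ d n x := fun n x => by
    simp only [hd, ContinuousMap.coe_mk, sub_nonneg]
    gcongr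
    linarith
  have hd1 : ∀ n x, d n x ≤ 1 := fun n x => by
    simp only [hd, ContinuousMap.coe_mk]
    have h1 : max 0 (min 1 (1 + n * h x)) ≤ 1 := max_le zero_le_one (min_le_left _ _)
    have h2 : 0 ≤ max 0 (min 1 (n * h x)) := le_max_left _ _
    linarith
  have hclose : ∀ n x, |{x | 0 ≤ h x}.indicator φ x - (χ n * φ) x| ≤ M * d n x := by
    intro n x
    rcases le_or_gt 0 (h x) with hx | hx
    · have h1 : 0 ≤ n * h x := by positivity
      rw [Set.indicator_of_mem (by exact hx)]
      have e : φ x - (χ n * φ) x = φ x * d n x := by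
        simp only [hχ, hd, ContinuousMap.mul_apply, ContinuousMap.coe_mk]
        rw [min_eq_left (by linarith : (1 : ℝ) ≤ 1 + n * h x), max_eq_right zero_le_one]
        ring
      rw [e, abs_mul, abs_of_nonneg (hd0 n x)]
      exact mul_le_mul_of_nonneg_right (hM x) (hd0 n x)
    · have h1 : n * h x ≤ 0 := mul_nonpos_of_nonneg_of_nonpos (by positivity) hx.le
      rw [Set.indicator_of_notMem (by simpa using hx)]
      have e : (χ n * φ) x = 0 := by
        simp only [hχ, ContinuousMap.mul_apply, ContinuousMap.coe_mk]
        rw [min_eq_right (by linarith), max_eq_left h1, zero_mul]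
      rw [e, sub_zero, abs_zero]
      exact mul_nonneg hM0 (hd0 n x)
  have hdlim : Tendsto (fun n => ∫ x, d n x ∂ν) atTop (𝓝 0) := by
    have := tendsto_integral_of_dominated_convergence (μ := ν) (F := fun n x => d n x)
      (f := fun _ => (0 : ℝ)) (fun _ => (1 : ℝ)) (fun n => (hint (d n)).aestronglyMeasurable)
      (integrable_const _) (fun n => ae_of_all _ fun x => by
        rw [Real.norm_of_nonneg (hd0 n x)]; exact hd1 n x) ?_
    · simpa using this
    · have hae : ∀ᵐ x ∂ν, h x ≠ 0 := by rw [ae_iff]; simpa using h0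
      filter_upwards [hae] with x hx
      refine tendsto_const_nhds.congr' ?_
      obtain ⟨n₀, hn₀⟩ := exists_nat_ge (1 / |h x|)
      filter_upwards [eventually_ge_atTop n₀] with n hn
      have hn' : 1 ≤ n * |h x| := by
        rw [div_le_iff₀ (abs_pos.2 hx)] at hn₀
        refine hn₀.trans ?_
        gcongr
      simp only [hd, ContinuousMap.coe_mk]
      rcases lt_or_gt_of_ne hx with hx | hx
      · rw [abs_of_neg hx] at hn'
        rw [min_eq_right (by linarith), min_eq_right (by linarith), max_eq_left (by linarith),
          max_eq_left (by linarith), sub_zero]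
      · rw [abs_of_pos hx] at hn'
        rw [min_eq_left (by linarith), min_eq_left (by linarith), sub_self]
  have hmeas : MeasurableSet {x | 0 ≤ h x} := measurableSet_le measurable_const h.continuous.measurable
  have hI : Integrable ({x | 0 ≤ h x}.indicator φ) ν := (hint φ).indicator hmeas
  rw [Metric.tendsto_nhds]
  intro ε hε
  have hsmall : ∀ᶠ n in atTop, M * (1 + 2 * |κ|) * ∫ x, d n x ∂ν < ε / 4 := by
    have := hdlim.const_mul (M * (1 + 2 * |κ|))
    rw [mul_zero] at this
    exact this.eventually_lt_const (by positivity)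
  obtain ⟨n, hn⟩ := hsmall.exists
  have hdn : 0 ≤ ∫ x, d n x ∂ν := integral_nonneg (hd0 n)
  have hν : |κ * ∫ x, (χ n * φ) x ∂ν - κ * ∫ x, {x | 0 ≤ h x}.indicator φ x ∂ν|
      ≤ |κ| * (M * ∫ x, d n x ∂ν) := by
    rw [← mul_sub, ← integral_sub (hint _) hI, abs_mul, ← integral_const_mul M]
    refine mul_le_mul_of_nonneg_left ?_ (abs_nonneg _)
    have h6 := norm_integral_le_of_norm_le (μ := ν)
      (f := fun x => (χ n * φ) x - {x | 0 ≤ h x}.indicator φ x) ((hint (d n)).const_mul M)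
      (ae_of_all _ fun x => by rw [norm_sub_rev]; exact hclose n x)
    exact h6
  have hdt := (hcont (d n)).const_mul M
  filter_upwards [hw, (Metric.tendsto_nhds.1 (hcont (χ n * φ))) (ε / 4) (by positivity),
    (Metric.tendsto_nhds.1 hdt) (ε / 4) (by positivity)] with t ht ht1 ht2
  rw [Real.dist_eq] at ht1 ht2 ⊢
  obtain ⟨Mg, _, hMg⟩ := (χ n * φ).exists_abs_le
  have hs1 : Summable fun i => w t i * {x | 0 ≤ h x}.indicator φ (z t i) :=
    summable_mul_of_abs_le ht.1 ht.2 (M := M) fun i => by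
      rcases le_or_gt 0 (h (z t i)) with hx | hx
      · rw [Set.indicator_of_mem (by exact hx)]; exact hM _
      · rw [Set.indicator_of_notMem (by simpa using hx), abs_zero]; exact hM0
  have h1 : |∑' i, w t i * {x | 0 ≤ h x}.indicator φ (z t i) - ∑' i, w t i * (χ n * φ) (z t i)|
      ≤ M * ∑' i, w t i * d n (z t i) := by
    rw [← hs1.tsum_sub (summable_mul_of_abs_le ht.1 ht.2 fun i => hMg (z t i)), ← tsum_mul_left]
    have h2 := (abs_tsum_mul_le ht.1 ht.2
      (f := fun i => {x | 0 ≤ h x}.indicator φ (z t i) - (χ n * φ) (z t i))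
      (g := fun i => M * d n (z t i)) (M := M) (fun i => by
        rw [abs_of_nonneg (mul_nonneg hM0 (hd0 _ _))]
        exact mul_le_of_le_one_right hM0 (hd1 _ _))
      (fun i => hclose n (z t i))).2
    simp only [mul_sub] at h2
    refine h2.trans_eq (tsum_congr fun i => ?_)
    ring
  have e : ∑' i, w t i * {x | 0 ≤ h x}.indicator φ (z t i) - κ * ∫ x, {x | 0 ≤ h x}.indicator φ x ∂ν
      = (∑' i, w t i * {x | 0 ≤ h x}.indicator φ (z t i) - ∑' i, w t i * (χ n * φ) (z t i))
        + (∑' i, w t i * (χ n * φ) (z t i) - κ * ∫ x, (χ n * φ) x ∂ν)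
        + (κ * ∫ x, (χ n * φ) x ∂ν - κ * ∫ x, {x | 0 ≤ h x}.indicator φ x ∂ν) := by ring
  rw [e]
  have h3 : M * ∑' i, w t i * d n (z t i) ≤ M * (κ * ∫ x, d n x ∂ν) + ε / 4 := by
    have := (abs_lt.1 ht2).2
    linarith
  have h4 : M * (κ * ∫ x, d n x ∂ν) ≤ M * (|κ| * ∫ x, d n x ∂ν) := by
    gcongr
    exact le_abs_self _
  have h5 := mul_nonneg hM0 hdn
  calc _ ≤ _ := abs_add_three _ _ _
    _ < ε := by nlinarith

end Moments

/-! ### The limit law -/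

theorem gammaMeasure_absolutelyContinuous (a : ℝ) : gammaMeasure a 1 ≪ volume :=
  withDensity_absolutelyContinuous _ _

theorem integral_gammaMeasure {a : ℝ} (ha : 0 < a) (f : ℝ → ℝ) :
    ∫ u, f u ∂(gammaMeasure a 1)
      = (Real.Gamma a)⁻¹ * ∫ u in Set.Ioi (0 : ℝ), u ^ (a - 1) * Real.exp (-u) * f u := by
  have hmeas : Measurable (gammaPDF a 1) := (measurable_gammaPDFReal a 1).ennreal_ofReal
  rw [gammaMeasure, integral_withDensity_eq_integral_toReal_smul hmeas
    (ae_of_all _ fun u => ENNReal.ofReal_lt_top), ← integral_const_mul,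
    ← integral_Ici_eq_integral_Ioi, ← integral_indicator measurableSet_Ici]
  congr 1
  funext u
  rw [gammaPDF, ENNReal.toReal_ofReal (gammaPDFReal_nonneg ha one_pos u), gammaPDFReal, smul_eq_mul]
  by_cases h : 0 ≤ u
  · rw [if_pos h, Set.indicator_of_mem (by exact h)]
    simp
    ring
  · rw [if_neg h, Set.indicator_of_notMem (by exact h), zero_mul]

theorem ae_gammaMeasure_pos {a : ℝ} : ∀ᵐ u ∂(gammaMeasure a 1), 0 < u := by
  rw [ae_iff]
  simp only [not_lt]
  change gammaMeasure a 1 (Set.Iic 0) = 0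
  rw [gammaMeasure, withDensity_apply _ measurableSet_Iic, setLIntegral_congr Iio_ae_eq_Iic.symm]
  exact lintegral_gammaPDF_of_nonpos le_rfl

/-- The Laplace transform of the gamma law at `a`; these values match the factors `α^{-k}` coming
from the poles of the zeta powers, with `α = a + 1`. -/
theorem integral_exp_neg_mul_gammaMeasure {k : ℕ} (hk : 1 ≤ k) (a : ℕ) :
    ∫ u, Real.exp (-(a * u)) ∂(gammaMeasure k 1) = ((a : ℝ) + 1)⁻¹ ^ k := by
  have hk0 : (0 : ℝ) < k := by exact_mod_cast hk
  rw [integral_gammaMeasure hk0]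
  have h := Real.integral_rpow_mul_exp_neg_mul_Ioi hk0 (by positivity : (0 : ℝ) < a + 1)
  have e : ∫ u in Set.Ioi (0 : ℝ), u ^ ((k : ℝ) - 1) * Real.exp (-u) * Real.exp (-(a * u))
      = ∫ u in Set.Ioi (0 : ℝ), u ^ ((k : ℝ) - 1) * Real.exp (-((a + 1) * u)) := by
    refine integral_congr_ae (ae_of_all _ fun u => ?_)
    simp only
    rw [mul_assoc, ← Real.exp_add]
    congr 2
    ring
  rw [e, h, mul_comm, mul_assoc, mul_inv_cancel₀ (Real.Gamma_pos_of_pos hk0).ne', mul_one, one_div,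
    Real.rpow_natCast]

/-- The point `e^{-u}` of the unit interval (truncated to `1` for `u < 0`). -/
noncomputable def expPoint (u : ℝ) : unitInterval := Set.projIcc 0 1 zero_le_one (Real.exp (-u))

theorem coe_expPoint {u : ℝ} (hu : 0 ≤ u) : (expPoint u : ℝ) = Real.exp (-u) := by
  rw [expPoint, Set.projIcc_of_mem zero_le_one
    (⟨(Real.exp_pos _).le, Real.exp_le_one_iff.2 (by linarith)⟩ : Real.exp (-u) ∈ Set.Icc (0 : ℝ) 1)]

theorem continuous_expPoint : Continuous expPoint :=
  continuous_projIcc.comp (by fun_prop)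

theorem continuous_expPoint_prod :
    Continuous fun q : ℝ × ℝ => (expPoint q.1, expPoint q.2) :=
  (continuous_expPoint.comp continuous_fst).prodMk (continuous_expPoint.comp continuous_snd)

/-- The law of `(e^{-U}, e^{-V})` for independent gamma variables of shapes `j` and `k`. -/
noncomputable def expGammaLaw (j k : ℕ) : Measure (unitInterval × unitInterval) :=
  ((gammaMeasure j 1).prod (gammaMeasure k 1)).map fun q => (expPoint q.1, expPoint q.2)

theorem isProbabilityMeasure_expGammaLaw {j k : ℕ} (hj : 1 ≤ j) (hk : 1 ≤ k) :
    IsProbabilityMeasure (expGammaLaw j k) := by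
  have := isProbabilityMeasure_gammaMeasure (by exact_mod_cast hj : (0 : ℝ) < j) one_pos
  have := isProbabilityMeasure_gammaMeasure (by exact_mod_cast hk : (0 : ℝ) < k) one_pos
  exact Measure.isProbabilityMeasure_map continuous_expPoint_prod.measurable.aemeasurable

theorem integral_monomial_expGammaLaw {j k : ℕ} (hj : 1 ≤ j) (hk : 1 ≤ k) (a b : ℕ) :
    ∫ x, (x.1 : ℝ) ^ a * (x.2 : ℝ) ^ b ∂(expGammaLaw j k)
      = ((a : ℝ) + 1)⁻¹ ^ j * ((b : ℝ) + 1)⁻¹ ^ k := by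
  have := isProbabilityMeasure_gammaMeasure (by exact_mod_cast hj : (0 : ℝ) < j) one_pos
  have := isProbabilityMeasure_gammaMeasure (by exact_mod_cast hk : (0 : ℝ) < k) one_pos
  rw [expGammaLaw, integral_map continuous_expPoint_prod.measurable.aemeasurable
    (by exact Continuous.aestronglyMeasurable (by fun_prop)),
    integral_prod_mul (f := fun u => (expPoint u : ℝ) ^ a) (g := fun v => (expPoint v : ℝ) ^ b),
    ← integral_exp_neg_mul_gammaMeasure hj, ← integral_exp_neg_mul_gammaMeasure hk]
  congr 1 <;>
  · refine integral_congr_ae ?_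
    filter_upwards [ae_gammaMeasure_pos] with u hu
    rw [coe_expPoint hu.le, ← Real.exp_nat_mul]
    congr 1
    ring

/-- By Fubini it suffices to fix `u`: then at most one `v > 0` lies on the level curve, and the
gamma law has no atoms and no mass on `v ≤ 0`. -/
theorem expGammaLaw_level_null {j k : ℕ} (hj : 1 ≤ j) (hk : 1 ≤ k) {c : ℝ} (hc : c ≠ 0) :
    expGammaLaw j k {x | (x.1 : ℝ) * (x.2 : ℝ) - c = 0} = 0 := by
  have := isProbabilityMeasure_gammaMeasure (by exact_mod_cast hj : (0 : ℝ) < j) one_pos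
  have := isProbabilityMeasure_gammaMeasure (by exact_mod_cast hk : (0 : ℝ) < k) one_pos
  have hm : MeasurableSet {x : unitInterval × unitInterval | (x.1 : ℝ) * (x.2 : ℝ) - c = 0} :=
    (isClosed_eq (by fun_prop) continuous_const).measurableSet
  rw [expGammaLaw, Measure.map_apply continuous_expPoint_prod.measurable hm,
    Measure.measure_prod_null (continuous_expPoint_prod.measurable hm)]
  refine ae_of_all _ fun u => ?_
  set S : Set ℝ := Prod.mk u ⁻¹' ((fun q : ℝ × ℝ => (expPoint q.1, expPoint q.2)) ⁻¹'
    {x | (x.1 : ℝ) * (x.2 : ℝ) - c = 0})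
  have hsub : (S ∩ Set.Ioi 0).Subsingleton := by
    intro v hv v' hv'
    have h1 : (expPoint u : ℝ) * (expPoint v : ℝ) - c = 0 := hv.1
    have h2 : (expPoint u : ℝ) * (expPoint v' : ℝ) - c = 0 := hv'.1
    have hv0 : 0 < v := hv.2
    have hv0' : 0 < v' := hv'.2
    rw [coe_expPoint hv0.le] at h1
    rw [coe_expPoint hv0'.le] at h2
    have h3 : (expPoint u : ℝ) ≠ 0 := fun h => hc (by rw [h] at h1; linarith)
    have h4 : Real.exp (-v) = Real.exp (-v') := mul_left_cancel₀ h3 (by linarith)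
    simpa using h4
  have h1 : gammaMeasure k 1 (S ∩ Set.Ioi 0) = 0 :=
    gammaMeasure_absolutelyContinuous _ (hsub.finite.measure_zero _)
  have h2 : gammaMeasure k 1 (Set.Ioi 0)ᶜ = 0 := by
    simpa [ae_iff] using! (ae_gammaMeasure_pos (a := k))
  refine measure_mono_null (fun v hv => ?_) (measure_union_null h1 h2)
  by_cases h : v ∈ Set.Ioi (0 : ℝ)
  · exact Or.inl ⟨hv, h⟩
  · exact Or.inr h

/-! ### The test function and its integral -/

/-- The weight `P₁[kn] P₂[n]` as a continuous function of `(k^{-σ}, n^{-σ})`, divided by their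
product. -/
noncomputable def momentWeight (P₁ P₂ : ℝ[X]) : C(unitInterval × unitInterval, ℝ) where
  toFun x := (max (x.1 : ℝ) (Real.exp (-1)) * max (x.2 : ℝ) (Real.exp (-1)))⁻¹ *
    (P₁.eval (1 + Real.log (max (x.1 : ℝ) (Real.exp (-1))) + Real.log (max (x.2 : ℝ) (Real.exp (-1)))) *
      P₂.eval (1 + Real.log (max (x.2 : ℝ) (Real.exp (-1)))))
  continuous_toFun := by
    have h : ∀ t : ℝ, max t (Real.exp (-1)) ≠ 0 := fun t =>
      (lt_of_lt_of_le (Real.exp_pos _) (le_max_right _ _)).ne'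
    have h1 : Continuous fun x : unitInterval × unitInterval => max (x.1 : ℝ) (Real.exp (-1)) := by
      fun_prop
    have h2 : Continuous fun x : unitInterval × unitInterval => max (x.2 : ℝ) (Real.exp (-1)) := by
      fun_prop
    have l1 := h1.log fun x => h _
    have l2 := h2.log fun x => h _
    exact ((h1.mul h2).inv₀ fun x => mul_ne_zero (h _) (h _)).mul
      ((P₁.continuous.comp ((continuous_const.add l1).add l2)).mul
        (P₂.continuous.comp (continuous_const.add l2)))

/-- The function `xy - e^{-1}`, whose nonnegativity set corresponds to `kn ≤ y`. -/
noncomputable def cutoffLevel : C(unitInterval × unitInterval, ℝ) where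
  toFun x := (x.1 : ℝ) * x.2 - Real.exp (-1)
  continuous_toFun := by fun_prop

/-- On `u + v ≤ 1` both `u` and `v` are at most `1`, so the truncations at `e^{-1}`, present only to
keep the weight continuous at the edges, are inactive. -/
theorem indicator_momentWeight (P₁ P₂ : ℝ[X]) {u v : ℝ} (hu : 0 ≤ u) (hv : 0 ≤ v) :
    {x | 0 ≤ cutoffLevel x}.indicator (momentWeight P₁ P₂) (expPoint u, expPoint v)
      = if u + v ≤ 1 then Real.exp (u + v) * (P₁.eval (1 - v - u) * P₂.eval (1 - v)) else 0 := by
  have hmem : (expPoint u, expPoint v) ∈ {x | 0 ≤ cutoffLevel x} ↔ u + v ≤ 1 := by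
    simp only [Set.mem_ofPred_eq, cutoffLevel, ContinuousMap.coe_mk, coe_expPoint hu, coe_expPoint hv,
      sub_nonneg, ← Real.exp_add, Real.exp_le_exp]
    constructor <;> intro h <;> linarith
  by_cases h : u + v ≤ 1
  · rw [Set.indicator_of_mem (hmem.2 h), if_pos h]
    simp only [momentWeight, ContinuousMap.coe_mk, coe_expPoint hu, coe_expPoint hv]
    rw [max_eq_left (Real.exp_le_exp.2 (by linarith)), max_eq_left (Real.exp_le_exp.2 (by linarith)),
      Real.log_exp, Real.log_exp, ← Real.exp_add, ← Real.exp_neg]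
    congr 2
    · ring
    · congr 1; ring
  · rw [Set.indicator_of_notMem (mt hmem.1 h), if_neg h]

theorem setIntegral_Ioi_ite_le (g : ℝ → ℝ) (b : ℝ) :
    ∫ u in Set.Ioi (0 : ℝ), (if u ≤ b then g u else 0) = ∫ u in Set.Ioc 0 b, g u := by
  have : (fun u : ℝ => if u ≤ b then g u else 0) = (Set.Iic b).indicator g := by
    funext u; simp [Set.indicator_apply]
  rw [this, setIntegral_indicator measurableSet_Iic, Set.Ioi_inter_Iic]

/-- The factor `e^u` of the weight cancels the exponential in the gamma density, leaving `u^r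
P₁(1-v-u)` on `0 < u ≤ 1-v`, whose integral is `Q_r(1-v)`. -/
theorem integral_gammaMeasure_cutoff (r : ℕ) (P₁ P₂ : ℝ[X]) {v : ℝ} (hv : 0 ≤ v) :
    ∫ u, {x | 0 ≤ cutoffLevel x}.indicator (momentWeight P₁ P₂) (expPoint u, expPoint v)
        ∂(gammaMeasure (r + 1 : ℕ) 1)
      = (Real.Gamma (r + 1 : ℕ))⁻¹ *
        if v ≤ 1 then Real.exp v * (fracConv r P₁ (1 - v) * P₂.eval (1 - v)) else 0 := by
  rw [integral_gammaMeasure (by positivity)]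
  congr 1
  have e : ∫ u in Set.Ioi (0 : ℝ), u ^ (((r + 1 : ℕ) : ℝ) - 1) * Real.exp (-u) *
        {x | 0 ≤ cutoffLevel x}.indicator (momentWeight P₁ P₂) (expPoint u, expPoint v)
      = ∫ u in Set.Ioi (0 : ℝ), (if u ≤ 1 - v then
          u ^ r * P₁.eval (1 - v - u) * (Real.exp v * P₂.eval (1 - v)) else 0) := by
    refine setIntegral_congr_fun measurableSet_Ioi fun u hu => ?_
    rw [indicator_momentWeight P₁ P₂ (le_of_lt hu) hv]
    by_cases h : u + v ≤ 1
    · rw [if_pos h, if_pos (by linarith), Real.exp_add, Nat.cast_succ, add_sub_cancel_right,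
        Real.rpow_natCast, Real.exp_neg]
      have := Real.exp_ne_zero u
      field_simp
    · rw [if_neg h, if_neg (by linarith), mul_zero]
  rw [e, setIntegral_Ioi_ite_le]
  split_ifs with h
  · rw [← intervalIntegral.integral_of_le (by linarith), intervalIntegral.integral_mul_const, fracConv]
    ring
  · rw [Set.Ioc_eq_empty (by linarith)]
    simp

/-- Integrating first in `u` gives `Q_r`; in `v` the exponentials cancel again, and the substitution
`x = 1 - v` turns `v^{r(r+1)-1}` into the stated kernel. -/
theorem integral_momentWeight {r : ℕ} (hr : 1 ≤ r) (P₁ P₂ : ℝ[X]) :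
    ∫ x, {x | 0 ≤ cutoffLevel x}.indicator (momentWeight P₁ P₂) x
        ∂(expGammaLaw (r + 1) (r * (r + 1)))
      = crossIntegral r P₁ P₂ /
        (Real.Gamma ((r : ℝ) + 1) * Real.Gamma ((r : ℝ) * ((r : ℝ) + 1))) := by
  have hR : 1 ≤ r * (r + 1) := Nat.mul_pos hr (by omega)
  have hR0 : (0 : ℝ) < (r * (r + 1) : ℕ) := by exact_mod_cast hR
  have := isProbabilityMeasure_gammaMeasure (by positivity : (0 : ℝ) < (r + 1 : ℕ)) one_pos
  have := isProbabilityMeasure_gammaMeasure hR0 one_pos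
  have hm : Measurable ({x | 0 ≤ cutoffLevel x}.indicator (momentWeight P₁ P₂)) :=
    (momentWeight P₁ P₂).continuous.measurable.indicator
      (measurableSet_le measurable_const cutoffLevel.continuous.measurable)
  obtain ⟨M, hM0, hM⟩ := (momentWeight P₁ P₂).exists_abs_le
  have hb : ∀ x, ‖{x | 0 ≤ cutoffLevel x}.indicator (momentWeight P₁ P₂) x‖ ≤ M := fun x =>
    (norm_indicator_le_norm_self _ _).trans (hM x)
  have hI : Integrable (fun q : ℝ × ℝ => {x | 0 ≤ cutoffLevel x}.indicator (momentWeight P₁ P₂)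
      (expPoint q.1, expPoint q.2))
      ((gammaMeasure (r + 1 : ℕ) 1).prod (gammaMeasure (r * (r + 1) : ℕ) 1)) :=
    Integrable.of_bound (hm.comp continuous_expPoint_prod.measurable).aestronglyMeasurable M
      (ae_of_all _ fun q => hb _)
  rw [expGammaLaw, integral_map continuous_expPoint_prod.measurable.aemeasurable
    hm.aestronglyMeasurable, integral_prod_symm _ hI]
  have e1 : ∫ v, (∫ u, {x | 0 ≤ cutoffLevel x}.indicator (momentWeight P₁ P₂) (expPoint u, expPoint v)
        ∂(gammaMeasure (r + 1 : ℕ) 1)) ∂(gammaMeasure (r * (r + 1) : ℕ) 1)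
      = ∫ v, (Real.Gamma (r + 1 : ℕ))⁻¹ *
        (if v ≤ 1 then Real.exp v * (fracConv r P₁ (1 - v) * P₂.eval (1 - v)) else 0)
          ∂(gammaMeasure (r * (r + 1) : ℕ) 1) := by
    refine integral_congr_ae ?_
    filter_upwards [ae_gammaMeasure_pos] with v hv
    exact integral_gammaMeasure_cutoff r P₁ P₂ hv.le
  have e2 : ∫ v in Set.Ioi (0 : ℝ), v ^ (((r * (r + 1) : ℕ) : ℝ) - 1) * Real.exp (-v) *
        (if v ≤ 1 then Real.exp v * (fracConv r P₁ (1 - v) * P₂.eval (1 - v)) else 0)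
      = crossIntegral r P₁ P₂ := by
    have e3 : ∫ v in Set.Ioi (0 : ℝ), v ^ (((r * (r + 1) : ℕ) : ℝ) - 1) * Real.exp (-v) *
          (if v ≤ 1 then Real.exp v * (fracConv r P₁ (1 - v) * P₂.eval (1 - v)) else 0)
        = ∫ v in Set.Ioi (0 : ℝ), (if v ≤ 1 then
          (1 - (1 - v)) ^ (r * (r + 1) - 1) * fracConv r P₁ (1 - v) * P₂.eval (1 - v) else 0) := by
      refine setIntegral_congr_fun measurableSet_Ioi fun v _ => ?_
      split_ifs with h
      · rw [← Nat.cast_pred hR, Real.rpow_natCast, Real.exp_neg, sub_sub_cancel]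
        have := Real.exp_ne_zero v
        field_simp
      · rw [mul_zero]
    rw [e3, setIntegral_Ioi_ite_le, ← intervalIntegral.integral_of_le zero_le_one,
      intervalIntegral.integral_comp_sub_left (fun x => (1 - x) ^ (r * (r + 1) - 1)
        * fracConv r P₁ x * P₂.eval x), sub_self, sub_zero, crossIntegral]
  refine e1.trans ?_
  rw [integral_const_mul, integral_gammaMeasure hR0, e2]
  push_cast
  rw [div_eq_mul_inv, mul_inv]
  ring

/-! ### Asymptotics of the diagonal sum -/

/-- The factor `(kn)^σ` supplied by the weight removes the damping in the double series, so no
regularization error remains. -/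
theorem pairTerm_mul_exp (r : ℕ) (σ : ℝ) (x : ℕ+ × ℕ+) :
    pairTerm r σ σ x * Real.exp (σ * Real.log (x.1 : ℕ) + σ * Real.log (x.2 : ℕ))
      = (divisorFn (r + 1) (x.1 * x.2) : ℝ) * divisorFn r x.2 / ((x.1 * x.2 : ℕ) : ℝ) := by
  have h1 : (0 : ℝ) < (x.1 : ℕ) := by exact_mod_cast x.1.pos
  have h2 : (0 : ℝ) < (x.2 : ℕ) := by exact_mod_cast x.2.pos
  have h : ∀ t : ℝ, 0 < t → t ^ (-1 - σ) * Real.exp (σ * Real.log t) = t⁻¹ := fun t ht => by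
    rw [mul_comm σ, ← Real.rpow_def_of_pos ht, ← Real.rpow_add ht, sub_add_cancel, Real.rpow_neg_one]
  rw [Real.exp_add, pairTerm]
  calc _ = (divisorFn (r + 1) (x.1 * x.2) : ℝ) * divisorFn r x.2
        * (((x.1 : ℕ) : ℝ) ^ (-1 - σ) * Real.exp (σ * Real.log (x.1 : ℕ)))
        * (((x.2 : ℕ) : ℝ) ^ (-1 - σ) * Real.exp (σ * Real.log (x.2 : ℕ))) := by ring
    _ = _ := by
      rw [h _ h1, h _ h2]
      push_cast
      rw [div_eq_mul_inv, mul_inv]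
      ring

/-- The diagonal sum as a truncated sum over all pairs. -/
theorem tsum_pairTerm_mul_indicator (r : ℕ) (P₁ P₂ : ℝ[X]) {y : ℝ} (hy : 1 < y) :
    ∑' x : ℕ+ × ℕ+, pairTerm r (Real.log y)⁻¹ (Real.log y)⁻¹ x *
      {x | 0 ≤ cutoffLevel x}.indicator (momentWeight P₁ P₂)
        (expPoint ((Real.log y)⁻¹ * Real.log (x.1 : ℕ)), expPoint ((Real.log y)⁻¹ * Real.log (x.2 : ℕ)))
      = diagonalSum r P₁ P₂ y := by
  set L := Real.log y
  have hL : 0 < L := Real.log_pos hy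
  have hy0 : 0 < y := by linarith
  set q : ℕ × ℕ → ℝ := fun p => if p.1 ∈ Finset.Icc 1 ⌊y⌋₊ ∧ p.2 ∈ Finset.Icc 1 ⌊y⌋₊ ∧ p.2 ∣ p.1 then
    ((divisorFn (r + 1) p.1 : ℝ) * smoothWeight P₁ y p.1)
      * ((divisorFn r p.2 : ℝ) * smoothWeight P₂ y p.2) / p.1 else 0 with hq
  have hsw : ∀ (P : ℝ[X]) (n : ℕ), 1 ≤ n → smoothWeight P y n = P.eval (1 - L⁻¹ * Real.log n) := by
    intro P n hn
    have hn0 : (0 : ℝ) < n := by exact_mod_cast hn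
    rw [smoothWeight, Real.log_div hy0.ne' hn0.ne']
    congr 1
    change (L - Real.log n) / L = _
    field_simp
  have hterm : ∀ x : ℕ+ × ℕ+, pairTerm r L⁻¹ L⁻¹ x *
      {x | 0 ≤ cutoffLevel x}.indicator (momentWeight P₁ P₂)
        (expPoint (L⁻¹ * Real.log (x.1 : ℕ)), expPoint (L⁻¹ * Real.log (x.2 : ℕ)))
      = q ((x.1 : ℕ) * (x.2 : ℕ), (x.2 : ℕ)) := by
    intro x
    have h1 : (1 : ℝ) ≤ (x.1 : ℕ) := by exact_mod_cast x.1.pos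
    have h2 : (1 : ℝ) ≤ (x.2 : ℕ) := by exact_mod_cast x.2.pos
    have hlog : Real.log ((x.1 * x.2 : ℕ) : ℝ) = Real.log (x.1 : ℕ) + Real.log (x.2 : ℕ) := by
      rw [Nat.cast_mul, Real.log_mul (by linarith) (by linarith)]
    rw [indicator_momentWeight P₁ P₂ (mul_nonneg (by positivity) (Real.log_nonneg h1))
      (mul_nonneg (by positivity) (Real.log_nonneg h2))]
    have hpos : 1 ≤ (x.1 : ℕ) * (x.2 : ℕ) := Nat.mul_pos x.1.pos x.2.pos
    have hiff : L⁻¹ * Real.log (x.1 : ℕ) + L⁻¹ * Real.log (x.2 : ℕ) ≤ 1 ↔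
        ((x.1 : ℕ) * (x.2 : ℕ) ∈ Finset.Icc 1 ⌊y⌋₊ ∧ (x.2 : ℕ) ∈ Finset.Icc 1 ⌊y⌋₊ ∧
          (x.2 : ℕ) ∣ (x.1 : ℕ) * (x.2 : ℕ)) := by
      have e : (L⁻¹ * Real.log (x.1 : ℕ) + L⁻¹ * Real.log (x.2 : ℕ) ≤ 1) ↔
          (x.1 : ℕ) * (x.2 : ℕ) ≤ ⌊y⌋₊ := by
        rw [← mul_add, ← hlog, inv_mul_le_iff₀ hL, mul_one, Nat.le_floor_iff hy0.le]
        exact Real.log_le_log_iff (by exact_mod_cast hpos) hy0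
      rw [e]
      have h3 : (x.2 : ℕ) ≤ (x.1 : ℕ) * (x.2 : ℕ) := Nat.le_mul_of_pos_left _ x.1.pos
      have h4 := x.2.pos
      simp only [Finset.mem_Icc, dvd_mul_left, and_true]
      omega
    simp only [hq]
    by_cases h : L⁻¹ * Real.log (x.1 : ℕ) + L⁻¹ * Real.log (x.2 : ℕ) ≤ 1
    · rw [if_pos h, if_pos (hiff.1 h), ← mul_assoc, pairTerm_mul_exp, hsw _ _ hpos, hsw _ _ x.2.pos,
        hlog]
      rw [show 1 - L⁻¹ * Real.log (x.2 : ℕ) - L⁻¹ * Real.log (x.1 : ℕ)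
        = 1 - L⁻¹ * (Real.log (x.1 : ℕ) + Real.log (x.2 : ℕ)) by ring]
      ring
    · rw [if_neg h, if_neg (mt hiff.2 h), mul_zero]
  simp_rw [hterm]
  -- The reindexing `(k, n) ↦ (kn, n)` matches pairs with the divisibility condition `n ∣ m`.
  have hinj : Function.Injective fun x : ℕ+ × ℕ+ => ((x.1 : ℕ) * (x.2 : ℕ), (x.2 : ℕ)) := by
    rintro ⟨a, b⟩ ⟨c, d⟩ h
    simp only [Prod.mk.injEq, PNat.coe_inj] at h
    obtain ⟨h1, rfl⟩ := h
    have : (a : ℕ) = c := Nat.eq_of_mul_eq_mul_right b.pos h1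
    rw [PNat.coe_injective this]
  have hsupp : Function.support q ⊆ Set.range fun x : ℕ+ × ℕ+ => ((x.1 : ℕ) * (x.2 : ℕ), (x.2 : ℕ)) := by
    rintro ⟨m, n⟩ h
    have h' : m ∈ Finset.Icc 1 ⌊y⌋₊ ∧ n ∈ Finset.Icc 1 ⌊y⌋₊ ∧ n ∣ m := by
      by_contra hn
      exact h (if_neg hn)
    obtain ⟨hm, hn, k, rfl⟩ := h'
    have hm1 := (Finset.mem_Icc.1 hm).1
    have hn1 := (Finset.mem_Icc.1 hn).1
    have hk : 0 < k := Nat.pos_of_ne_zero fun h => by simp [h] at hm1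
    exact ⟨(⟨k, hk⟩, ⟨n, hn1⟩), by simp [mul_comm]⟩
  rw [hinj.tsum_eq hsupp, tsum_eq_sum (s := Finset.Icc 1 ⌊y⌋₊ ×ˢ Finset.Icc 1 ⌊y⌋₊)]
  · rw [Finset.sum_product, diagonalSum]
    refine Finset.sum_congr rfl fun m hm => Finset.sum_congr rfl fun n hn => ?_
    simp only [hq, hm, hn, true_and]
  · intro p hp
    refine if_neg fun h => hp (Finset.mem_product.2 ⟨h.1, h.2.1⟩)

/-- The asymptotic evaluation of the diagonal sum. -/
theorem tendsto_diagonalSum {r : ℕ} (hr : 1 ≤ r) (P₁ P₂ : ℝ[X]) :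
    Tendsto (fun y : ℝ => (Real.log y)⁻¹ ^ ((r + 1) ^ 2) * diagonalSum r P₁ P₂ y) atTop
      (𝓝 (arithConst (r + 1) * (crossIntegral r P₁ P₂ /
        (Real.Gamma ((r : ℝ) + 1) * Real.Gamma ((r : ℝ) * ((r : ℝ) + 1)))))) := by
  have hR : 1 ≤ r * (r + 1) := Nat.mul_pos hr (by omega)
  have := isProbabilityMeasure_expGammaLaw (by omega : 1 ≤ r + 1) hR
  have hlog : Tendsto (fun y : ℝ => (Real.log y)⁻¹) atTop (𝓝[>] 0) :=
    tendsto_inv_atTop_nhdsGT_zero.comp Real.tendsto_log_atTop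
  have h := tendsto_tsum_indicator_of_moments (l := 𝓝[>] (0 : ℝ)) (κ := arithConst (r + 1))
    (ν := expGammaLaw (r + 1) (r * (r + 1)))
    (w := fun σ (x : ℕ+ × ℕ+) => σ ^ ((r + 1) ^ 2) * pairTerm r σ σ x)
    (z := fun σ x => (expPoint (σ * Real.log (x.1 : ℕ)), expPoint (σ * Real.log (x.2 : ℕ))))
    (by
      filter_upwards [self_mem_nhdsWithin] with σ hσ
      have hσ : 0 < σ := hσ
      exact ⟨fun x => mul_nonneg (by positivity) (pairTerm_nonneg _ _ _ _),
        (summable_pairTerm r hσ hσ).mul_left _⟩)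
    (fun a b => by
      rw [integral_monomial_expGammaLaw (by omega) hR]
      refine (tendsto_tsum_pairTerm r (by positivity : (0 : ℝ) < (a : ℝ) + 1)
        (by positivity : (0 : ℝ) < (b : ℝ) + 1)).congr' ?_
      filter_upwards [self_mem_nhdsWithin] with σ hσ
      have hσ : 0 < σ := hσ
      rw [← tsum_mul_left]
      refine tsum_congr fun x => ?_
      have h1 : (1 : ℝ) ≤ (x.1 : ℕ) := by exact_mod_cast x.1.pos
      have h2 : (1 : ℝ) ≤ (x.2 : ℕ) := by exact_mod_cast x.2.pos
      -- Multiplying by the `c`-th power of `t^{-σ}` replaces `σ` by `(c+1)σ`, so each moment is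
      -- again a value of the double series.
      have e : ∀ (t : ℝ) (c : ℕ), 1 ≤ t →
          t ^ (-1 - ((c : ℝ) + 1) * σ) = t ^ (-1 - σ) * (expPoint (σ * Real.log t) : ℝ) ^ c := by
        intro t c ht
        have ht0 : 0 < t := by linarith
        rw [coe_expPoint (mul_nonneg hσ.le (Real.log_nonneg ht)), ← Real.exp_nat_mul,
          show (c : ℝ) * -(σ * Real.log t) = Real.log t * (-(c * σ)) by ring,
          ← Real.rpow_def_of_pos ht0, ← Real.rpow_add ht0]
        congr 1
        ring
      simp only [pairTerm]
      rw [e _ a h1, e _ b h2]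
      ring)
    (momentWeight P₁ P₂) cutoffLevel
    (expGammaLaw_level_null (by omega) hR (Real.exp_ne_zero _))
  rw [integral_momentWeight hr] at h
  refine (h.comp hlog).congr' ?_
  filter_upwards [eventually_gt_atTop 1] with y hy
  simp only [Function.comp_apply, mul_assoc]
  rw [tsum_mul_left, tsum_pairTerm_mul_indicator r P₁ P₂ hy]

/-! ### Conclusion -/

theorem crossMoment_sub_crossMain_isLittleO {r : ℕ} (hr : 1 ≤ r) {θ : ℝ} (hθ₀ : 0 < θ)
    (hθ₁ : θ < 1 / 2) (P₁ P₂ : ℝ[X]) :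
    (fun T : ℝ => crossMoment r θ P₁ P₂ T - (crossMain r θ P₁ P₂ T : ℂ)) =o[atTop]
      fun T : ℝ => T * Real.log (T ^ θ) ^ ((r + 1) ^ 2) := by
  set c : ℝ := arithConst (r + 1) * (crossIntegral r P₁ P₂ /
        (Real.Gamma ((r : ℝ) + 1) * Real.Gamma ((r : ℝ) * ((r : ℝ) + 1)))) with hc
  have hy : Tendsto (fun T : ℝ => T ^ θ) atTop atTop := tendsto_rpow_atTop hθ₀
  have hL : Tendsto (fun T : ℝ => Real.log (T ^ θ)) atTop atTop := Real.tendsto_log_atTop.comp hy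
  have h1 : (fun T : ℝ => crossMoment r θ P₁ P₂ T - ((T * diagonalSum r P₁ P₂ (T ^ θ) : ℝ) : ℂ))
      =o[atTop] fun T : ℝ => T * Real.log (T ^ θ) ^ ((r + 1) ^ 2) := by
    refine (crossMoment_sub_diagonal_isLittleO r hθ₀ hθ₁ P₁ P₂).trans_isBigO (IsBigO.of_bound 1 ?_)
    filter_upwards [hL.eventually_ge_atTop 1] with T hT
    rw [one_mul, norm_mul]
    refine le_mul_of_one_le_right (norm_nonneg _) ?_
    rw [norm_pow, Real.norm_of_nonneg (by linarith)]
    exact one_le_pow₀ hT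
  have h2 : (fun T : ℝ => T * diagonalSum r P₁ P₂ (T ^ θ) - crossMain r θ P₁ P₂ T)
      =o[atTop] fun T : ℝ => T * Real.log (T ^ θ) ^ ((r + 1) ^ 2) := by
    have h3 : (fun T : ℝ => (Real.log (T ^ θ))⁻¹ ^ ((r + 1) ^ 2) * diagonalSum r P₁ P₂ (T ^ θ) - c)
        =o[atTop] fun _ => (1 : ℝ) := by
      rw [isLittleO_one_iff]
      have := ((tendsto_diagonalSum hr P₁ P₂).comp hy).sub_const c
      rwa [← hc, sub_self] at this
    refine ((isBigO_refl (fun T : ℝ => T * Real.log (T ^ θ) ^ ((r + 1) ^ 2)) atTop).mul_isLittleO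
      h3).congr' ?_ (by simp)
    filter_upwards [hL.eventually_ge_atTop 1] with T hT
    have hT0 : Real.log (T ^ θ) ≠ 0 := by linarith
    rw [crossMain, hc, inv_pow]
    field_simp
  have h4 : (fun T : ℝ => ((T * diagonalSum r P₁ P₂ (T ^ θ) - crossMain r θ P₁ P₂ T : ℝ) : ℂ))
      =o[atTop] fun T : ℝ => T * Real.log (T ^ θ) ^ ((r + 1) ^ 2) := by
    rw [← isLittleO_norm_left]
    simpa only [Complex.norm_real] using h2.norm_left
  refine (h1.add h4).congr_left fun T => ?_
  push_cast
  ring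

theorem lemma2p2 (r : ℕ) (hr : 1 ≤ r) (θ : ℝ) (hθ₀ : 0 < θ) (hθ₁ : θ < 1 / 2) (P₁ P₂ : ℝ[X]) :
    ((fun T : ℝ => crossMoment r θ P₁ P₂ T - (crossMain r θ P₁ P₂ T : ℂ)) =o[atTop]
        fun T : ℝ => T * Real.log (T ^ θ) ^ ((r + 1) ^ 2)) ∧
      (crossIntegral r P₁ P₂ ≠ 0 →
        crossMoment r θ P₁ P₂ ~[atTop] fun T : ℝ => (crossMain r θ P₁ P₂ T : ℂ)) := by
  have h := crossMoment_sub_crossMain_isLittleO hr hθ₀ hθ₁ P₁ P₂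
  refine ⟨h, fun hne => ?_⟩
  set c : ℝ := arithConst (r + 1) / (Real.Gamma ((r : ℝ) + 1) * Real.Gamma ((r : ℝ) * ((r : ℝ) + 1)))
    * crossIntegral r P₁ P₂ with hc
  have hr0 : (0 : ℝ) < r := by exact_mod_cast hr
  have hc0 : c ≠ 0 := by
    have h1 := (Real.Gamma_pos_of_pos (by positivity : 0 < (r : ℝ) + 1)).ne'
    have h2 := (Real.Gamma_pos_of_pos (by positivity : 0 < (r : ℝ) * ((r : ℝ) + 1))).ne'
    exact mul_ne_zero (div_ne_zero (arithConst_ne_zero r) (mul_ne_zero h1 h2)) hne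
  -- The main term is exactly `c` times the normalizer with `c ≠ 0`, so an error small against the
  -- normalizer is small against the main term.
  refine h.trans_isBigO (IsBigO.of_bound |c|⁻¹ (Eventually.of_forall fun T => ?_))
  have e : crossMain r θ P₁ P₂ T = c * (T * Real.log (T ^ θ) ^ ((r + 1) ^ 2)) := by
    rw [crossMain, hc]
    ring
  rw [e, Complex.norm_real, norm_mul c, Real.norm_eq_abs c, ← mul_assoc,
    inv_mul_cancel₀ (abs_ne_zero.2 hc0), one_mul]
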